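/- Let $N \ge 0$, $K\ge 1$ be integers and let $m=(m_1,\dots,m_N)\in[0,1]^N$. Consider $K$ independent, uniformly distributed files $W_1,\dots,W_K$ of $L$ bits each and $N$ non-colluding databases. The placement is uncoded: for every bit of every file one chooses a set $S\subseteq[N]$ (possibly empty), and the bit is stored exactly in the databases of $S$; the content $Z_n$ of database $n$ consists of the bits placed in it and must satisfy $H(Z_n)\le m_nKL$. When file $\theta\in[K]$ is desired, the user sends to each database $n$ a query $Q_n^{[\theta]}$, where $(Q_1^{[\theta]},\dots,Q_N^{[\theta]})$ is independent of the files, and database $n$ returns an answer $A_n^{[\theta]}$ that is a function of $Q_n^{[\theta]}$ and $Z_n$ (queries and answers have countable alphabets). Privacy requires that, for every $n$, the joint law of $(Q_n^{[\theta]},A_n^{[\theta]},W_1,\dots,W_K)$ is the same for all $\theta\in[K]$. A number $d \in [0,\infty]$ is an achievable normalized download cost if there is a sequence of such schemes with file sizes $L\to\infty$ such that, for every $\theta$, $$H\bigl(W_\theta\mid Q_1^{[\theta]},\dots,Q_N^{[\theta]},A_1^{[\theta]},\dots,A_N^{[\theta]}\bigr)=o(L)\quad\text{and}\quad \limsup_{L\to\infty}\frac1L\sum_{n=1}^N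 H(A_n^{[\theta]})\le d.$$ Let $D^*(m)$ be the infimum of all achievable $d$ ($=\infty$ if there is none). All entropies are in bits. Theorem. $D^*(m)$ equals the optimal value of the linear program $$\min_{\alpha_S\ge 0}\ \sum_{\ell=1}^N\ \sum_{S\subseteq[N]:|S|=\ell}\alpha_S\Bigl(1+\frac1\ell+\cdots+\frac1{\ell^{K-1}}\Bigr)\quad\text{subject to}\quad \sum_{S\subseteq[N]:|S|\ge1}\alpha_S=1,\qquad \sum_{S\ni n}\alpha_S\le m_n\ \ (n\in[N]).$$ If the program is infeasible, its value is $\infty$, and so is $D^*(m)$; if it is feasible, its minimum is attained and equals $D^*(m)$. -/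

import Mathlib

open MeasureTheory ProbabilityTheory Filter
open scoped ENNReal Topology

namespace HetPIR

noncomputable section

/-- Shannon entropy `H(X)`, in bits, of a random variable `X` with a countable alphabet.
It takes values in `[0, ∞]`, so that no summability convention is involved. -/
def entropy {Ω α : Type*} [MeasurableSpace Ω] (μ : Measure Ω) (X : Ω → α) : ℝ≥0∞ :=
  ∑' x : α, ENNReal.ofReal (Real.negMulLog (μ.real (X ⁻¹' {x})) / Real.log 2)

/-- Conditional Shannon entropy `H(X | Y) = ∑ y, P(Y = y) H(X | Y = y)`, in bits. -/
def condEntropy {Ω α β : Type*} [MeasurableSpace Ω] (μ : Measure Ω) (X : Ω → α) (Y : Ω → β) :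
    ℝ≥0∞ :=
  ∑' y : β, μ (Y ⁻¹' {y}) * entropy (ProbabilityTheory.cond μ (Y ⁻¹' {y})) X

/-- A private information retrieval scheme, with uncoded placement, for `K` files of `L` bits
each and `N` non-colluding databases, whose `n`-th database stores at most `m n * K * L` bits.
Files, databases and bit positions are indexed from `0`. -/
structure Scheme {N : ℕ} (m : Fin N → ℝ) (K L : ℕ) where
  /-- the underlying probability space -/
  Ω : Type
  [measurableSpaceΩ : MeasurableSpace Ω]
  μ : Measure Ω
  [isProbabilityMeasure : IsProbabilityMeasure μ]
  /-- the (countable) alphabet of the queries -/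
  Query : Type
  [countableQuery : Countable Query]
  [measurableSpaceQuery : MeasurableSpace Query]
  [discreteQuery : DiscreteMeasurableSpace Query]
  /-- the (countable) alphabet of the answers -/
  Answer : Type
  [countableAnswer : Countable Answer]
  [measurableSpaceAnswer : MeasurableSpace Answer]
  [discreteAnswer : DiscreteMeasurableSpace Answer]
  /-- the files: `W ω k i` is the `i`-th bit of the `k`-th file -/
  W : Ω → Fin K → Fin L → Bool
  measurable_W : Measurable W
  /-- the files are independent and uniformly distributed `L`-bit strings -/
  uniform_W : ∀ w : Fin K → Fin L → Bool, μ (W ⁻¹' {w}) = ((2 : ℝ≥0∞) ^ (K * L))⁻¹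
  /-- uncoded placement: `placement (k, i)` is the set of the databases that store the `i`-th
  bit of the `k`-th file, so `W_{k,S}` consists of the bits `i` with `placement (k, i) = S` -/
  placement : Fin K × Fin L → Finset (Fin N)
  /-- `Q θ n` is the query to the `n`-th database when the `θ`-th file is desired -/
  Q : Fin K → Fin N → Ω → Query
  measurable_Q : ∀ θ n, Measurable (Q θ n)
  /-- the queries are independent of the files -/
  indep_Q : ∀ θ, IndepFun W (fun ω n => Q θ n ω) μ
  /-- the `n`-th database answers by a function of the received query and of its content -/
  answer : (n : Fin N) → Query → ({p : Fin K × Fin L // n ∈ placement p} → Bool) → Answer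
  /-- storage constraint `H(Z_n) ≤ m_n K L` -/
  storage : ∀ n : Fin N,
    entropy μ (fun ω (p : {p : Fin K × Fin L // n ∈ placement p}) => W ω p.1.1 p.1.2) ≤
      ENNReal.ofReal (m n * (K * L))
  /-- privacy: the joint law of query, answer and files at each database does not depend on
  the desired file -/
  privacy : ∀ (n : Fin N) (θ θ' : Fin K),
    IdentDistrib
      (fun ω => (Q θ n ω, answer n (Q θ n ω) (fun p => W ω p.1.1 p.1.2), W ω))
      (fun ω => (Q θ' n ω, answer n (Q θ' n ω) (fun p => W ω p.1.1 p.1.2), W ω)) μ μ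

attribute [instance] Scheme.measurableSpaceΩ Scheme.isProbabilityMeasure Scheme.countableQuery
  Scheme.measurableSpaceQuery Scheme.discreteQuery Scheme.countableAnswer
  Scheme.measurableSpaceAnswer Scheme.discreteAnswer

namespace Scheme

variable {N : ℕ} {m : Fin N → ℝ} {K L : ℕ} (P : Scheme m K L)

/-- The content `Z_n` of the `n`-th database. -/
def Z (n : Fin N) (ω : P.Ω) : {p : Fin K × Fin L // n ∈ P.placement p} → Bool :=
  fun p => P.W ω p.1.1 p.1.2

/-- The answer of the `n`-th database when the `θ`-th file is desired. -/
def A (θ : Fin K) (n : Fin N) (ω : P.Ω) : P.Answer :=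
  P.answer n (P.Q θ n ω) (P.Z n ω)

/-- The remaining uncertainty `H(W_θ | Q_{1:N}, A_{1:N})` about the desired file. -/
def equivocation (θ : Fin K) : ℝ≥0∞ :=
  condEntropy P.μ (fun ω => P.W ω θ)
    (fun ω => ((fun n => P.Q θ n ω : Fin N → P.Query), (fun n => P.A θ n ω : Fin N → P.Answer)))

/-- The download cost `D = ∑ n, H(A_n)` in bits when the `θ`-th file is desired. -/
def downloadCost (θ : Fin K) : ℝ≥0∞ :=
  ∑ n : Fin N, entropy P.μ (P.A θ n)

end Scheme

/-- The normalized download cost `d` is achievable: there are schemes with file sizes `L → ∞`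
that are reliable, `H(W_θ | Q_{1:N}, A_{1:N}) = o(L)`, and download asymptotically at most `d`
bits per bit of the desired file. -/
def IsAchievable {N : ℕ} (m : Fin N → ℝ) (K : ℕ) (d : ℝ≥0∞) : Prop :=
  ∃ (L : ℕ → ℕ) (P : (j : ℕ) → Scheme m K (L j)),
    Tendsto L atTop atTop ∧
    (∀ θ : Fin K, Tendsto (fun j => (P j).equivocation θ / (L j : ℝ≥0∞)) atTop (𝓝 0)) ∧
    (∀ θ : Fin K, limsup (fun j => (P j).downloadCost θ / (L j : ℝ≥0∞)) atTop ≤ d)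

/-- The optimal normalized download cost `D*`; it is `∞` if retrieval is impossible. -/
def optimalCost {N : ℕ} (m : Fin N → ℝ) (K : ℕ) : ℝ≥0∞ :=
  sInf {d : ℝ≥0∞ | IsAchievable m K d}

/-- The feasible set of the linear program. -/
def feasible {N : ℕ} (m : Fin N → ℝ) : Set (Finset (Fin N) → ℝ) :=
  {α | (∀ S, 0 ≤ α S) ∧
    ∑ S : Finset (Fin N) with 1 ≤ S.card, α S = 1 ∧
    ∀ n : Fin N, ∑ S : Finset (Fin N) with n ∈ S, α S ≤ m n}

/-- The objective function of the linear program. -/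
def objective {N : ℕ} (K : ℕ) (α : Finset (Fin N) → ℝ) : ℝ :=
  ∑ l ∈ Finset.Icc 1 N, ∑ S : Finset (Fin N) with S.card = l,
    α S * ∑ i ∈ Finset.range K, 1 / (l : ℝ) ^ i

end

end HetPIR

/-!
# The download cost of private information retrieval from uncoded heterogeneous storage

The queries are independent of the files, so once the query vector is fixed every answer is a
function on the finite uniform space of all files, and all the entropies in question are averages
over the queries of entropies of such functions (`unifEntropy`, `unifCondEntropy`). For these only
the kernels matter, and submodularity (`unifEntropy_submodular`) is the one inequality behind the
converse. The dictionary is given by `Scheme.equivocation_eq`,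
`Scheme.lintegral_unifEntropy_resp_le` and `Scheme.entropy_A_le`.

*Converse.* For a set `T` of databases and a set `J` of files let `R(T, J)` be the entropy of the
answers of `T` given the queries, the files in `J` and the contents of all databases outside `T`. The
chain rule that first reveals the answer of some `n ∈ T` and then its content gives
`R(T, J) ≥ H(A_n | …) + R(T \ {n}, J)`. In the average over `n ∈ T`, the first terms add up, by
subadditivity, to at least the residual of `T` for any other desired file `k`, because privacy allows
the exchange of the desired file in each single answer; and for `k ∉ J` decoding gives
`R(T, J) ≥ ∑_{S ⊆ T} |W_{k,S}| + R(T, J ∪ {k})` up to the equivocation. Every `S ⊆ T` is contained in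
`|T| - |S|` of the sets `T \ {n}`, and by induction the weight of `S` is divided by `|S|` with every
further file (`Scheme.sum_weight_le_residual`). The average over the cyclic orderings of the files
shows that the fractions `α_S` of the bits placed exactly in `S` satisfy
`objective α ≤ D / L + o(1)` (`Scheme.objective_share_le`). Bits that are not stored cannot be
decoded, hence `α_∅ → 0`, and a limit point of the fractions is feasible
(`exists_feasible_of_isAchievable`).

*Achievability.* A feasible `α` is the placement: up to rounding, `α_S L` bits of each file go to `S`.
For `|S| = ℓ ≥ 2` they form `ℓ - 1` symbols, numbered from `1`, and a dummy symbol `0`. The query to a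
database in `S` is a uniform vector in `(ℤ/ℓ)ᴷ`, whose coordinate for the desired file is shifted by
the number of the database; the answer is the sum of the selected symbols. The interference is the
same at all databases of `S`, one of which selects the dummy in the desired file, so all symbols can
be decoded, and nothing is downloaded for the zero query, which has probability `ℓ⁻ᴷ`. The cost is
`ℓ (1 - ℓ⁻ᴷ) / (ℓ - 1) = 1 + 1/ℓ + ⋯ + 1/ℓᴷ⁻¹` per bit (`isAchievable_of_feasible`). Bits stored in one
database only are downloaded for all files.
-/

namespace HetPIR

noncomputable section

/-! ### Entropy of functions on a finite uniform space -/

section UniformEntropy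

open Classical in
/-- The number of points `w'` of the finite space `Ω` with `f w' = f w`. -/
def fiberCard {Ω α : Type*} [Fintype Ω] (f : Ω → α) (w : Ω) : ℕ :=
  (Finset.univ.filter fun w' => f w' = f w).card

/-- The entropy, in bits, of `f` under the uniform distribution on the finite space `Ω`, written as
the mean over `w : Ω` of `log₂ (1 / P(f = f w))`. It depends only on the kernel of `f`, and no
structure on the codomain is needed. -/
def unifEntropy {Ω α : Type*} [Fintype Ω] (f : Ω → α) : ℝ :=
  (∑ w, Real.logb 2 (Fintype.card Ω / fiberCard f w)) / Fintype.card Ω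

/-- The conditional entropy `H(f | c) = H(f, c) - H(c)` of functions on a finite uniform space. -/
def unifCondEntropy {Ω α γ : Type*} [Fintype Ω] (f : Ω → α) (c : Ω → γ) : ℝ :=
  unifEntropy (fun w => (f w, c w)) - unifEntropy c

variable {Ω α β γ δ : Type*} [Fintype Ω]

lemma fiberCard_pos (f : Ω → α) (w : Ω) : 0 < fiberCard f w := by
  classical
  exact Finset.card_pos.2 ⟨w, by simp⟩

lemma fiberCard_le_of_kernel {f : Ω → α} {g : Ω → β} {w : Ω}
    (h : ∀ w', g w' = g w → f w' = f w) : fiberCard g w ≤ fiberCard f w := by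
  classical
  exact Finset.card_le_card fun w' hw' => by simpa using h w' (by simpa using hw')

lemma unifEntropy_mono {f : Ω → α} {g : Ω → β} (h : ∀ w w', g w = g w' → f w = f w') :
    unifEntropy f ≤ unifEntropy g := by
  unfold unifEntropy
  gcongr with w
  · norm_num
  · have h1 : (0 : ℝ) < fiberCard f w := by exact_mod_cast fiberCard_pos f w
    have h2 : (0 : ℝ) < Fintype.card Ω := by exact_mod_cast Fintype.card_pos_iff.2 ⟨w⟩
    positivity
  · exact_mod_cast fiberCard_pos g w
  · exact fiberCard_le_of_kernel fun w' => h w' w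

lemma unifEntropy_congr {f : Ω → α} {g : Ω → β} (h : ∀ w w', g w = g w' ↔ f w = f w') :
    unifEntropy f = unifEntropy g :=
  le_antisymm (unifEntropy_mono fun w w' => (h w w').1) (unifEntropy_mono fun w w' => (h w w').2)

lemma unifEntropy_const [Nonempty Ω] (a : α) : unifEntropy (fun _ : Ω => a) = 0 := by
  have h : (Fintype.card Ω : ℝ) ≠ 0 := by exact_mod_cast Fintype.card_ne_zero
  simp [unifEntropy, fiberCard, h]

lemma unifEntropy_injective [Nonempty Ω] {f : Ω → α} (hf : Function.Injective f) :
    unifEntropy f = Real.logb 2 (Fintype.card Ω) := by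
  have h : (Fintype.card Ω : ℝ) ≠ 0 := by exact_mod_cast Fintype.card_ne_zero
  have h1 : ∀ w, fiberCard f w = 1 := fun w =>
    Finset.card_eq_one.2 ⟨w, by ext; simp [hf.eq_iff]⟩
  simp [unifEntropy, h1, h]

/-- A set of points that lies in a single fibre has total weight at most `1` when every point is
weighted by the inverse size of its fibre. -/
lemma sum_inv_fiberCard_le_one (f : Ω → α) (s : Finset Ω)
    (hs : ∀ w ∈ s, ∀ w' ∈ s, f w = f w') : ∑ w ∈ s, (fiberCard f w : ℝ)⁻¹ ≤ 1 := by
  classical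
  rcases s.eq_empty_or_nonempty with rfl | ⟨w₀, hw₀⟩
  · simp
  · have h0 : (0 : ℝ) < fiberCard f w₀ := by exact_mod_cast fiberCard_pos f w₀
    have h1 : ∀ w ∈ s, (fiberCard f w : ℝ)⁻¹ = (fiberCard f w₀ : ℝ)⁻¹ := fun w hw => by
      simp only [fiberCard, hs w hw w₀ hw₀]
    rw [Finset.sum_congr rfl h1, Finset.sum_const, nsmul_eq_mul, ← div_eq_mul_inv, div_le_one h0]
    exact_mod_cast Finset.card_le_card fun w hw => by simpa using hs w hw w₀ hw₀

lemma logb_two_le_sub_one_div {x : ℝ} (hx : 0 < x) : Real.logb 2 x ≤ (x - 1) / Real.log 2 := by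
  exact div_le_div_of_nonneg_right (Real.log_le_sub_one_of_pos hx) (Real.log_nonneg (by norm_num))

lemma sum_logb_two_nonpos {x : Ω → ℝ} (hx : ∀ w, 0 < x w) (h : ∑ w, x w ≤ Fintype.card Ω) :
    ∑ w, Real.logb 2 (x w) ≤ 0 := by
  calc ∑ w, Real.logb 2 (x w) ≤ ∑ w, (x w - 1) / Real.log 2 :=
        Finset.sum_le_sum fun w _ => logb_two_le_sub_one_div (hx w)
    _ = (∑ w, x w - Fintype.card Ω) / Real.log 2 := by
        rw [← Finset.sum_div, Finset.sum_sub_distrib]; simp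
    _ ≤ 0 := div_nonpos_of_nonpos_of_nonneg (by linarith) (Real.log_nonneg (by norm_num))

lemma unifEntropy_le_logb_card [Nonempty Ω] [Fintype α] (f : Ω → α) :
    unifEntropy f ≤ Real.logb 2 (Fintype.card α) := by
  classical
  have hn : (0 : ℝ) < Fintype.card Ω := by exact_mod_cast Fintype.card_pos
  obtain ⟨w₀⟩ := ‹Nonempty Ω›
  have hm : (0 : ℝ) < Fintype.card α := by exact_mod_cast Fintype.card_pos_iff.2 ⟨f w₀⟩
  have hf : ∀ w, (0 : ℝ) < fiberCard f w := fun w => by exact_mod_cast fiberCard_pos f w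
  have key : ∑ w, Real.logb 2 (Fintype.card Ω / fiberCard f w / Fintype.card α) ≤ 0 := by
    refine sum_logb_two_nonpos (fun w => by have := hf w; positivity) ?_
    have h1 : ∑ w, (fiberCard f w : ℝ)⁻¹ ≤ Fintype.card α := by
      rw [← Finset.sum_fiberwise Finset.univ f]
      calc _ ≤ ∑ _a : α, (1 : ℝ) := Finset.sum_le_sum fun a _ =>
            sum_inv_fiberCard_le_one f _ fun w hw w' hw' => by simp_all
        _ = _ := by simp
    calc ∑ w, (Fintype.card Ω : ℝ) / fiberCard f w / Fintype.card α
        = (Fintype.card Ω / Fintype.card α) * ∑ w, (fiberCard f w : ℝ)⁻¹ := by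
          rw [Finset.mul_sum]; exact Finset.sum_congr rfl fun w _ => by ring
      _ ≤ (Fintype.card Ω / Fintype.card α) * Fintype.card α := by gcongr
      _ = Fintype.card Ω := by field_simp
  have h2 : ∑ w, Real.logb 2 (Fintype.card Ω / fiberCard f w / Fintype.card α)
      = ∑ w, Real.logb 2 (Fintype.card Ω / fiberCard f w)
        - Fintype.card Ω * Real.logb 2 (Fintype.card α) := by
    rw [Finset.sum_congr rfl fun w _ => Real.logb_div (by have := hf w; positivity) hm.ne']
    simp
  rw [unifEntropy, div_le_iff₀ hn]
  linarith

/-- Submodularity of entropy. By `log x ≤ x - 1` it is enough to bound a sum of ratios of fibre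
sizes, which is done by counting the triples `(w, a, b)` with `(f, c) a = (f, c) w` and
`(g, c) b = (g, c) w`. -/
lemma unifEntropy_submodular (f : Ω → α) (g : Ω → β) (c : Ω → γ) :
    unifEntropy (fun w => (f w, g w, c w)) + unifEntropy c ≤
      unifEntropy (fun w => (f w, c w)) + unifEntropy (fun w => (g w, c w)) := by
  classical
  rcases isEmpty_or_nonempty Ω with hΩ | hΩ
  · simp [unifEntropy]
  have hn : (0 : ℝ) < Fintype.card Ω := by exact_mod_cast Fintype.card_pos
  set X : Ω → ℝ := fun w => fiberCard (fun w => (f w, c w)) w with hX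
  set Y : Ω → ℝ := fun w => fiberCard (fun w => (g w, c w)) w with hY
  set V : Ω → ℝ := fun w => fiberCard (fun w => (f w, g w, c w)) w with hV
  set C : Ω → ℝ := fun w => fiberCard c w with hC
  have hXp : ∀ w, 0 < X w := fun w => Nat.cast_pos.2 (fiberCard_pos _ w)
  have hYp : ∀ w, 0 < Y w := fun w => Nat.cast_pos.2 (fiberCard_pos _ w)
  have hVp : ∀ w, 0 < V w := fun w => Nat.cast_pos.2 (fiberCard_pos _ w)
  have hCp : ∀ w, 0 < C w := fun w => Nat.cast_pos.2 (fiberCard_pos _ w)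
  have count : ∑ w, X w * Y w / (V w * C w) ≤ Fintype.card Ω := by
    have h1 : ∀ w, X w * Y w / (V w * C w) = ∑ a, ∑ b,
        if (f a = f w ∧ c a = c w) ∧ (g b = g w ∧ c b = c w) then (V w)⁻¹ * (C w)⁻¹ else 0 := by
      intro w
      have hx : X w = ∑ a, if f a = f w ∧ c a = c w then (1 : ℝ) else 0 := by
        simp [hX, fiberCard]
      have hy : Y w = ∑ b, if g b = g w ∧ c b = c w then (1 : ℝ) else 0 := by
        simp [hY, fiberCard]
      rw [hx, hy, Finset.sum_mul_sum, Finset.sum_div]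
      refine Finset.sum_congr rfl fun a _ => ?_
      rw [Finset.sum_div]
      refine Finset.sum_congr rfl fun b _ => ?_
      by_cases h1 : f a = f w ∧ c a = c w <;> by_cases h2 : g b = g w ∧ c b = c w <;>
        simp [h1, h2, mul_comm]
    have h2 : ∀ a b, (∑ w, if (f a = f w ∧ c a = c w) ∧ (g b = g w ∧ c b = c w) then
        (V w)⁻¹ * (C w)⁻¹ else 0) ≤ if c b = c a then (C a)⁻¹ else 0 := by
      intro a b
      rw [← Finset.sum_filter]
      by_cases hab : c b = c a
      · rw [if_pos hab]
        have : ∀ w ∈ Finset.univ.filter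
            (fun w => (f a = f w ∧ c a = c w) ∧ (g b = g w ∧ c b = c w)),
            (V w)⁻¹ * (C w)⁻¹ = (V w)⁻¹ * (C a)⁻¹ := by
          intro w hw
          simp only [Finset.mem_filter, Finset.mem_univ, true_and] at hw
          simp only [hC, fiberCard, hw.1.2]
        rw [Finset.sum_congr rfl this, ← Finset.sum_mul]
        refine mul_le_of_le_one_left (inv_nonneg.2 (hCp a).le) ?_
        refine sum_inv_fiberCard_le_one _ _ fun w hw w' hw' => ?_
        simp only [Finset.mem_filter, Finset.mem_univ, true_and] at hw hw'
        simp [← hw.1.1, ← hw.1.2, ← hw.2.1, ← hw'.1.1, ← hw'.1.2, ← hw'.2.1]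
      · rw [if_neg hab]
        refine (Finset.sum_eq_zero fun w hw => ?_).le
        simp only [Finset.mem_filter, Finset.mem_univ, true_and] at hw
        exact absurd (hw.2.2.trans hw.1.2.symm) hab
    calc ∑ w, X w * Y w / (V w * C w) = ∑ a, ∑ b, ∑ w,
          if (f a = f w ∧ c a = c w) ∧ (g b = g w ∧ c b = c w) then (V w)⁻¹ * (C w)⁻¹ else 0 := by
          rw [Finset.sum_congr rfl fun w _ => h1 w, Finset.sum_comm]
          exact Finset.sum_congr rfl fun a _ => Finset.sum_comm
      _ ≤ ∑ a, ∑ b, if c b = c a then (C a)⁻¹ else 0 :=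
          Finset.sum_le_sum fun a _ => Finset.sum_le_sum fun b _ => h2 a b
      _ = ∑ _a : Ω, (1 : ℝ) := by
          refine Finset.sum_congr rfl fun a _ => ?_
          rw [← Finset.sum_filter, Finset.sum_const, nsmul_eq_mul]
          exact mul_inv_cancel₀ (hCp a).ne'
      _ = Fintype.card Ω := by simp
  have key : ∑ w, Real.logb 2 (X w * Y w / (V w * C w)) ≤ 0 :=
    sum_logb_two_nonpos (fun w => by have := hXp w; have := hYp w; have := hVp w; have := hCp w
                                     positivity) count
  have split : ∑ w, Real.logb 2 (X w * Y w / (V w * C w)) =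
      ∑ w, Real.logb 2 (Fintype.card Ω / V w) + ∑ w, Real.logb 2 (Fintype.card Ω / C w)
        - ∑ w, Real.logb 2 (Fintype.card Ω / X w) - ∑ w, Real.logb 2 (Fintype.card Ω / Y w) := by
    rw [← Finset.sum_add_distrib, ← Finset.sum_sub_distrib, ← Finset.sum_sub_distrib]
    refine Finset.sum_congr rfl fun w _ => ?_
    have := (hXp w).ne'; have := (hYp w).ne'; have := (hVp w).ne'; have := (hCp w).ne'
    rw [Real.logb_div (by positivity) (by positivity), Real.logb_mul (by positivity)
      (by positivity), Real.logb_mul (by positivity) (by positivity), Real.logb_div hn.ne' this,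
      Real.logb_div hn.ne' ‹_›, Real.logb_div hn.ne' ‹_›, Real.logb_div hn.ne' ‹_›]
    ring
  unfold unifEntropy
  rw [← add_div, ← add_div]
  refine div_le_div_of_nonneg_right ?_ hn.le
  simp only [hX, hY, hV, hC] at split key
  linarith

lemma unifCondEntropy_nonneg (f : Ω → α) (c : Ω → γ) : 0 ≤ unifCondEntropy f c :=
  sub_nonneg.2 (unifEntropy_mono fun _ _ h => (Prod.ext_iff.1 h).2)

/-- Monotonicity in the first argument: it is enough that `(g, c)` determines `f`. -/
lemma unifCondEntropy_mono {f : Ω → α} {g : Ω → β} {c : Ω → γ}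
    (h : ∀ w w', g w = g w' → c w = c w' → f w = f w') :
    unifCondEntropy f c ≤ unifCondEntropy g c := by
  refine sub_le_sub_right (unifEntropy_mono fun w w' hw => ?_) _
  obtain ⟨h1, h2⟩ := Prod.ext_iff.1 hw
  exact Prod.ext (h w w' h1 h2) h2

/-- Conditioning on more does not increase the entropy. -/
lemma unifCondEntropy_anti {f : Ω → α} {c : Ω → γ} {d : Ω → δ}
    (h : ∀ w w', c w = c w' → d w = d w') : unifCondEntropy f c ≤ unifCondEntropy f d := by
  have h1 := unifEntropy_submodular f c d
  have h2 : unifEntropy (fun w => (f w, c w)) = unifEntropy (fun w => (f w, c w, d w)) :=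
    unifEntropy_congr fun w w' => by simpa using fun _ => h w w'
  have h3 : unifEntropy c = unifEntropy (fun w => (c w, d w)) :=
    unifEntropy_congr fun w w' => by simpa using h w w'
  unfold unifCondEntropy
  linarith

lemma unifCondEntropy_congr_right {f : Ω → α} {c : Ω → γ} {d : Ω → δ}
    (h : ∀ w w', c w = c w' ↔ d w = d w') : unifCondEntropy f c = unifCondEntropy f d :=
  le_antisymm (unifCondEntropy_anti fun w w' => (h w w').1)
    (unifCondEntropy_anti fun w w' => (h w w').2)

lemma unifCondEntropy_chain (f : Ω → α) (g : Ω → β) (c : Ω → γ) :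
    unifCondEntropy (fun w => (f w, g w)) c =
      unifCondEntropy f c + unifCondEntropy g (fun w => (f w, c w)) := by
  have h : unifEntropy (fun w => ((f w, g w), c w)) = unifEntropy (fun w => (g w, f w, c w)) :=
    unifEntropy_congr fun w w' => by simp; tauto
  unfold unifCondEntropy
  linarith

lemma unifCondEntropy_chain' (f : Ω → α) (g : Ω → β) (c : Ω → γ) :
    unifCondEntropy (fun w => (f w, g w)) c =
      unifCondEntropy g c + unifCondEntropy f (fun w => (g w, c w)) := by
  rw [← unifCondEntropy_chain]
  exact le_antisymm (unifCondEntropy_mono fun w w' h _ => by simp_all)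
    (unifCondEntropy_mono fun w w' h _ => by simp_all)

lemma unifCondEntropy_const [Nonempty Ω] (f : Ω → α) (a : γ) :
    unifCondEntropy f (fun _ => a) = unifEntropy f := by
  rw [unifCondEntropy, unifEntropy_const, sub_zero]
  exact (unifEntropy_congr fun w w' => by simp)

lemma unifCondEntropy_le_unifEntropy (f : Ω → α) (c : Ω → γ) :
    unifCondEntropy f c ≤ unifEntropy f := by
  rcases isEmpty_or_nonempty Ω with hΩ | hΩ
  · simp [unifCondEntropy, unifEntropy]
  · exact (unifCondEntropy_anti (d := fun _ => ()) fun _ _ _ => rfl).trans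
      (unifCondEntropy_const f ()).le

lemma unifCondEntropy_le_logb_card [Nonempty Ω] (f : Ω → α) (c : Ω → γ) :
    unifCondEntropy f c ≤ Real.logb 2 (Fintype.card Ω) :=
  (unifCondEntropy_le_unifEntropy f c).trans <|
    (unifEntropy_mono (g := (id : Ω → Ω)) fun w w' h => by rw [show w = w' from h]).trans
      (unifEntropy_le_logb_card _)

lemma unifCondEntropy_finset_le_sum {ι : Type*} (f : ι → Ω → α) (c : Ω → γ) (T : Finset ι) :
    unifCondEntropy (fun w (n : T) => f n w) c ≤ ∑ n ∈ T, unifCondEntropy (f n) c := by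
  classical
  induction T using Finset.induction_on with
  | empty =>
    rw [Finset.sum_empty, unifCondEntropy]
    exact sub_nonpos.2 (unifEntropy_mono fun w w' h => by simp [h, funext_iff])
  | insert a s ha ih =>
    rw [Finset.sum_insert ha]
    calc _ ≤ unifCondEntropy (fun w => (f a w, fun n : s => f n w)) c := by
          refine unifCondEntropy_mono fun w w' h _ => ?_
          simp only [Prod.mk.injEq, funext_iff, Subtype.forall] at h
          funext ⟨n, hn⟩
          rcases Finset.mem_insert.1 hn with rfl | hn
          · exact h.1
          · exact h.2 n hn
      _ = _ := unifCondEntropy_chain _ _ _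
      _ ≤ _ := by
          gcongr
          exact (unifCondEntropy_anti fun w w' h => (Prod.ext_iff.1 h).2).trans ih

end UniformEntropy

/-! ### Entropy of sets of bits -/

/-- The bits of the files `w` at the positions in `B`. -/
def bitsAt {K L : ℕ} (B : Finset (Fin K × Fin L)) (w : Fin K → Fin L → Bool) (p : B) : Bool :=
  w p.1.1 p.1.2

lemma bitsAt_eq_iff {K L : ℕ} {B : Finset (Fin K × Fin L)} {w w' : Fin K → Fin L → Bool} :
    bitsAt B w = bitsAt B w' ↔ ∀ p ∈ B, w p.1 p.2 = w' p.1 p.2 := by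
  simp [bitsAt, funext_iff]

lemma logb_card_files (K L : ℕ) :
    Real.logb 2 (Fintype.card (Fin K → Fin L → Bool)) = (K * L : ℕ) := by
  have : ((Fintype.card (Fin K → Fin L → Bool) : ℕ) : ℝ) = 2 ^ (K * L) := by
    simp [← pow_mul, mul_comm]
  rw [this, Real.logb_pow, Real.logb_self_eq_one (by norm_num)]; simp

lemma unifEntropy_bool_le {Ω ι : Type*} [Fintype Ω] [Nonempty Ω] [Fintype ι] (f : Ω → ι → Bool) :
    unifEntropy f ≤ Fintype.card ι := by
  classical
  refine (unifEntropy_le_logb_card f).trans (le_of_eq ?_)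
  simp [Real.logb_pow]

/-- Distinct bits are independent and uniform. Both `H(B) ≤ #B` and `H(Bᶜ) ≤ #Bᶜ` are
cardinality bounds, and subadditivity forces equality. -/
lemma unifEntropy_bitsAt {K L : ℕ} (B : Finset (Fin K × Fin L)) :
    unifEntropy (bitsAt B) = B.card := by
  classical
  have h1 : ∀ B : Finset (Fin K × Fin L), unifEntropy (bitsAt B) ≤ B.card := fun B => by
    simpa using unifEntropy_bool_le (bitsAt B)
  refine le_antisymm (h1 B) ?_
  have h2 : ((K * L : ℕ) : ℝ) ≤ unifEntropy (bitsAt B) + unifEntropy (bitsAt Bᶜ) := by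
    rw [← logb_card_files, ← unifEntropy_injective (f := fun w => (bitsAt B w, bitsAt Bᶜ w))]
    · have h3 := unifCondEntropy_le_unifEntropy (bitsAt B) (bitsAt Bᶜ)
      rw [unifCondEntropy] at h3
      linarith
    · intro w w' h
      simp only [Prod.mk.injEq, bitsAt_eq_iff] at h
      funext k i
      by_cases hB : (k, i) ∈ B
      · exact h.1 _ hB
      · exact h.2 _ (Finset.mem_compl.2 hB)
  have h3 := h1 Bᶜ
  have h4 : (B.card : ℝ) + (Bᶜ).card = (K * L : ℕ) := by
    have := Finset.card_add_card_compl B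
    simp only [Fintype.card_prod, Fintype.card_fin] at this
    exact_mod_cast this
  linarith

lemma unifCondEntropy_bitsAt {K L : ℕ} (B C : Finset (Fin K × Fin L)) :
    unifCondEntropy (bitsAt B) (bitsAt C) = (B \ C).card := by
  classical
  have h : unifEntropy (fun w => (bitsAt B w, bitsAt C w)) = unifEntropy (bitsAt (B ∪ C)) := by
    refine unifEntropy_congr fun w w' => ?_
    simp only [Prod.mk.injEq, bitsAt_eq_iff, Finset.mem_union]
    exact ⟨fun h => ⟨fun p hp => h p (Or.inl hp), fun p hp => h p (Or.inr hp)⟩,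
      fun h p hp => hp.elim (h.1 p) (h.2 p)⟩
  rw [unifCondEntropy, h, unifEntropy_bitsAt, unifEntropy_bitsAt, ← Finset.card_sdiff_add_card B C]
  push_cast; ring

/-! ### Shannon entropy of functions of a uniform variable -/

section UnifProb

variable {Ω α γ : Type*} [Fintype Ω]

open Classical in
/-- The probability of `f = a` under the uniform distribution on the finite space `Ω`. -/
def unifProb (f : Ω → α) (a : α) : ℝ :=
  (Finset.univ.filter fun w => f w = a).card / (Fintype.card Ω : ℝ)

lemma unifProb_nonneg (f : Ω → α) (a : α) : 0 ≤ unifProb f a := by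
  unfold unifProb; positivity

lemma unifProb_le_one (f : Ω → α) (a : α) : unifProb f a ≤ 1 := by
  unfold unifProb
  refine div_le_one_of_le₀ ?_ (by positivity)
  exact_mod_cast Finset.card_le_univ _

lemma unifProb_eq_zero {f : Ω → α} {a : α} (h : ∀ w, f w ≠ a) : unifProb f a = 0 := by
  simp [unifProb, h]

lemma sum_unifProb_eq [Nonempty Ω] (f : Ω → α) (s : Finset α) (hs : ∀ w, f w ∈ s) :
    ∑ a ∈ s, unifProb f a = 1 := by
  classical
  have hn : (Fintype.card Ω : ℝ) ≠ 0 := by exact_mod_cast Fintype.card_ne_zero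
  have := Finset.card_eq_sum_card_fiberwise (s := Finset.univ) (f := f) (t := s) fun w _ => hs w
  simp only [unifProb]
  rw [← Finset.sum_div, div_eq_one_iff_eq hn, ← Finset.card_univ, this]
  push_cast; rfl

lemma sum_unifProb_prod (f : Ω → α) (c : Ω → γ) (s : Finset α) (hs : ∀ w, f w ∈ s) (b : γ) :
    ∑ a ∈ s, unifProb (fun w => (f w, c w)) (a, b) = unifProb c b := by
  classical
  have := Finset.card_eq_sum_card_fiberwise (s := Finset.univ.filter fun w => c w = b)
    (f := f) (t := s) fun w _ => hs w
  simp only [unifProb]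
  rw [← Finset.sum_div, this]
  push_cast
  congr 1
  refine Finset.sum_congr rfl fun a _ => ?_
  rw [Finset.filter_filter]
  simp [and_comm]

lemma sum_negMulLog_unifProb (f : Ω → α) (s : Finset α) (hs : ∀ w, f w ∈ s) :
    ∑ a ∈ s, Real.negMulLog (unifProb f a) / Real.log 2 = unifEntropy f := by
  classical
  rcases isEmpty_or_nonempty Ω with hΩ | hΩ
  · simp [unifEntropy, unifProb]
  have hn : (Fintype.card Ω : ℝ) ≠ 0 := by exact_mod_cast Fintype.card_ne_zero
  unfold unifEntropy
  rw [← Finset.sum_fiberwise_of_maps_to (s := Finset.univ) (g := f) (t := s) fun w _ => hs w,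
    Finset.sum_div]
  refine Finset.sum_congr rfl fun a _ => ?_
  have h1 : ∀ w ∈ Finset.univ.filter fun w => f w = a,
      Real.logb 2 (Fintype.card Ω / fiberCard f w) = -Real.logb 2 (unifProb f a) := by
    intro w hw
    rw [← Real.logb_inv]
    simp only [Finset.mem_filter, Finset.mem_univ, true_and] at hw
    subst hw
    simp only [unifProb, fiberCard, inv_div]
  rw [Finset.sum_congr rfl h1, Finset.sum_const, nsmul_eq_mul, Real.negMulLog, Real.logb]
  simp only [unifProb]
  ring

/-- `unifEntropy` is the Shannon entropy of a uniform variable. -/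
lemma tsum_negMulLog_unifProb (f : Ω → α) :
    ∑' a, ENNReal.ofReal (Real.negMulLog (unifProb f a) / Real.log 2) =
      ENNReal.ofReal (unifEntropy f) := by
  classical
  rw [tsum_eq_sum (s := Finset.univ.image f), ← ENNReal.ofReal_sum_of_nonneg,
    sum_negMulLog_unifProb f _ (by simp)]
  · exact fun a _ => div_nonneg (Real.negMulLog_nonneg (unifProb_nonneg f a) (unifProb_le_one f a))
      (Real.log_nonneg (by norm_num))
  · intro a ha
    rw [unifProb_eq_zero fun w hw => ha (by simp [← hw])]
    simp

lemma unifProb_prod_le (f : Ω → α) (c : Ω → γ) (a : α) (b : γ) :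
    unifProb (fun w => (f w, c w)) (a, b) ≤ unifProb c b := by
  classical
  unfold unifProb
  gcongr
  rename_i w
  simp +contextual

/-- The mean of the entropies of `f` given `c = b` is `H(f | c)`. -/
lemma tsum_unifProb_mul_entropy (f : Ω → α) (c : Ω → γ) :
    ∑' b, ENNReal.ofReal (unifProb c b) * ∑' a, ENNReal.ofReal
      (Real.negMulLog (unifProb (fun w => (f w, c w)) (a, b) / unifProb c b) / Real.log 2) =
      ENNReal.ofReal (unifCondEntropy f c) := by
  classical
  have hlog : 0 ≤ Real.log 2 := Real.log_nonneg (by norm_num)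
  set s := Finset.univ.image f
  set t := Finset.univ.image c
  have hs : ∀ w, f w ∈ s := by simp [s]
  have ht : ∀ w, c w ∈ t := by simp [t]
  have term_nonneg : ∀ a b, 0 ≤
      Real.negMulLog (unifProb (fun w => (f w, c w)) (a, b) / unifProb c b) / Real.log 2 :=
    fun a b => div_nonneg (Real.negMulLog_nonneg
      (div_nonneg (unifProb_nonneg _ _) (unifProb_nonneg _ _))
      (div_le_one_of_le₀ (unifProb_prod_le f c a b) (unifProb_nonneg _ _))) hlog
  have real_eq : ∀ b, unifProb c b * ∑ a ∈ s,
      Real.negMulLog (unifProb (fun w => (f w, c w)) (a, b) / unifProb c b) / Real.log 2 =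
      ∑ a ∈ s, Real.negMulLog (unifProb (fun w => (f w, c w)) (a, b)) / Real.log 2
        - Real.negMulLog (unifProb c b) / Real.log 2 := by
    intro b
    rcases (unifProb_nonneg c b).eq_or_lt with h0 | h0
    · have h1 : ∀ a, unifProb (fun w => (f w, c w)) (a, b) = 0 := fun a =>
        le_antisymm ((unifProb_prod_le f c a b).trans h0.symm.le) (unifProb_nonneg _ _)
      simp [h1, ← h0]
    · have h1 : Real.negMulLog (unifProb c b) / Real.log 2 = ∑ a ∈ s,
          -(unifProb (fun w => (f w, c w)) (a, b) * Real.log (unifProb c b) / Real.log 2) := by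
        rw [Finset.sum_neg_distrib, ← Finset.sum_div, ← Finset.sum_mul,
          sum_unifProb_prod f c s hs b, Real.negMulLog]
        ring
      rw [h1, Finset.mul_sum, ← Finset.sum_sub_distrib]
      refine Finset.sum_congr rfl fun a _ => ?_
      rcases (unifProb_nonneg (fun w => (f w, c w)) (a, b)).eq_or_lt with h2 | h2
      · simp [← h2]
      · rw [Real.negMulLog, Real.negMulLog, Real.log_div h2.ne' h0.ne']
        field_simp
        ring
  have inner : ∀ b, ENNReal.ofReal (unifProb c b) * ∑' a, ENNReal.ofReal
      (Real.negMulLog (unifProb (fun w => (f w, c w)) (a, b) / unifProb c b) / Real.log 2) =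
      ENNReal.ofReal (∑ a ∈ s, Real.negMulLog (unifProb (fun w => (f w, c w)) (a, b)) / Real.log 2
        - Real.negMulLog (unifProb c b) / Real.log 2) := by
    intro b
    rw [tsum_eq_sum (s := s), ← ENNReal.ofReal_sum_of_nonneg fun a _ => term_nonneg a b,
      ← ENNReal.ofReal_mul (unifProb_nonneg c b), real_eq]
    intro a ha
    rw [unifProb_eq_zero (a := (a, b)) fun w hw => by
      have h : f w = a := congrArg Prod.fst hw
      exact ha (h ▸ hs w)]
    simp
  have nonneg : ∀ b, 0 ≤ ∑ a ∈ s, Real.negMulLog (unifProb (fun w => (f w, c w)) (a, b))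
      / Real.log 2 - Real.negMulLog (unifProb c b) / Real.log 2 := fun b =>
    real_eq b ▸ mul_nonneg (unifProb_nonneg _ _) (Finset.sum_nonneg fun a _ => term_nonneg a b)
  rw [tsum_congr inner, tsum_eq_sum (s := t), ← ENNReal.ofReal_sum_of_nonneg fun b _ => nonneg b]
  · congr 1
    rw [Finset.sum_sub_distrib, sum_negMulLog_unifProb c t ht, Finset.sum_comm,
      ← Finset.sum_product', sum_negMulLog_unifProb (fun w => (f w, c w)) (s ×ˢ t)
        fun w => Finset.mem_product.2 ⟨hs w, ht w⟩]
    rfl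
  · intro b hb
    rw [← inner b, unifProb_eq_zero (f := c) fun w hw => hb (by rw [← hw]; exact ht w)]
    simp

end UnifProb

/-! ### Entropies of a scheme as averages over the queries -/

lemma negMulLog_add_le {x y : ℝ} (hx : 0 ≤ x) (hy : 0 ≤ y) :
    Real.negMulLog (x + y) ≤ Real.negMulLog x + Real.negMulLog y := by
  rcases hx.eq_or_lt with rfl | hx
  · simp
  rcases hy.eq_or_lt with rfl | hy
  · simp
  have h1 := Real.log_le_log hx (by linarith : x ≤ x + y)
  have h2 := Real.log_le_log hy (by linarith : y ≤ x + y)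
  simp only [Real.negMulLog]
  nlinarith

lemma negMulLog_sum_le {ι : Type*} (s : Finset ι) (x : ι → ℝ) (hx : ∀ i ∈ s, 0 ≤ x i) :
    Real.negMulLog (∑ i ∈ s, x i) ≤ ∑ i ∈ s, Real.negMulLog (x i) := by
  classical
  induction s using Finset.induction_on with
  | empty => simp
  | insert a s ha ih =>
    rw [Finset.sum_insert ha, Finset.sum_insert ha]
    refine (negMulLog_add_le (hx a (by simp)) (Finset.sum_nonneg fun i hi =>
      hx i (Finset.mem_insert_of_mem hi))).trans ?_
    gcongr
    exact ih fun i hi => hx i (Finset.mem_insert_of_mem hi)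

section UniformFiles

variable {Ω : Type*} [MeasurableSpace Ω] {μ : Measure Ω} {K L : ℕ}
  {W : Ω → Fin K → Fin L → Bool}

lemma measure_preimage_of_uniform (hW : Measurable W)
    (hu : ∀ w, μ (W ⁻¹' {w}) = ((2 : ℝ≥0∞) ^ (K * L))⁻¹) {α : Type*}
    (f : (Fin K → Fin L → Bool) → α) (a : α) :
    μ (W ⁻¹' {w | f w = a}) = ENNReal.ofReal (unifProb f a) := by
  classical
  have h : W ⁻¹' {w | f w = a} = ⋃ w ∈ Finset.univ.filter fun w => f w = a, W ⁻¹' {w} := by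
    ext; simp
  have hcard : (Fintype.card (Fin K → Fin L → Bool) : ℝ) = 2 ^ (K * L) := by
    simp [← pow_mul, mul_comm]
  rw [h, measure_biUnion_finset]
  · rw [Finset.sum_congr rfl fun w _ => hu w, Finset.sum_const, nsmul_eq_mul, ← div_eq_mul_inv,
      unifProb, ENNReal.ofReal_div_of_pos (by simp), hcard, ENNReal.ofReal_natCast,
      ENNReal.ofReal_pow (by norm_num), ENNReal.ofReal_ofNat]
  · intro a _ b _ hab
    exact Disjoint.preimage _ (by simpa using hab)
  · exact fun w _ => hW (measurableSet_singleton w)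

lemma entropy_comp_of_uniform (hW : Measurable W)
    (hu : ∀ w, μ (W ⁻¹' {w}) = ((2 : ℝ≥0∞) ^ (K * L))⁻¹) {α : Type*}
    (f : (Fin K → Fin L → Bool) → α) :
    entropy μ (fun ω => f (W ω)) = ENNReal.ofReal (unifEntropy f) := by
  rw [← tsum_negMulLog_unifProb, entropy]
  refine tsum_congr fun a => ?_
  have : (fun ω => f (W ω)) ⁻¹' {a} = W ⁻¹' {w | f w = a} := rfl
  rw [this, Measure.real, measure_preimage_of_uniform hW hu,
    ENNReal.toReal_ofReal (unifProb_nonneg f a)]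

/-- The content of a database has as many bits of entropy as bits. -/
lemma entropy_content (hW : Measurable W)
    (hu : ∀ w, μ (W ⁻¹' {w}) = ((2 : ℝ≥0∞) ^ (K * L))⁻¹) (B : Finset (Fin K × Fin L))
    (p : Fin K × Fin L → Prop) (hp : ∀ x, x ∈ B ↔ p x) :
    entropy μ (fun ω (x : {x // p x}) => W ω x.1.1 x.1.2) = (B.card : ℝ≥0∞) := by
  rw [entropy_comp_of_uniform hW hu fun w (x : {x // p x}) => w x.1.1 x.1.2,
    unifEntropy_congr (g := bitsAt B) fun w w' => by
      rw [bitsAt_eq_iff]; simp [hp, funext_iff],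
    unifEntropy_bitsAt, ENNReal.ofReal_natCast]

end UniformFiles

namespace Scheme

variable {N : ℕ} {m : Fin N → ℝ} {K L : ℕ} (P : Scheme m K L)

/-- The answer of the `n`-th database to the query `x`, as a function of the files. -/
def resp (n : Fin N) (x : P.Query) (w : Fin K → Fin L → Bool) : P.Answer :=
  P.answer n x fun p => w p.1.1 p.1.2

/-- The vector of all queries when the `θ`-th file is desired. -/
def queries (θ : Fin K) (ω : P.Ω) (n : Fin N) : P.Query := P.Q θ n ω

/-- The answers of all databases to the query vector `q`, as a function of the files. -/
def respAll (q : Fin N → P.Query) (w : Fin K → Fin L → Bool) (n : Fin N) : P.Answer :=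
  P.resp n (q n) w

lemma measurable_queries (θ : Fin K) : Measurable (P.queries θ) :=
  measurable_pi_lambda _ fun n => P.measurable_Q θ n

lemma measure_W_eq {α : Type*} (f : (Fin K → Fin L → Bool) → α) (a : α) :
    P.μ (P.W ⁻¹' {w | f w = a}) = ENNReal.ofReal (unifProb f a) :=
  measure_preimage_of_uniform P.measurable_W P.uniform_W f a

/-- Given the query vector, a statement about the files has its probability under the uniform
distribution. -/
lemma measure_queries_inter {α : Type*} (θ : Fin K) (q : Fin N → P.Query)
    (f : (Fin K → Fin L → Bool) → α) (a : α) :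
    P.μ (P.queries θ ⁻¹' {q} ∩ P.W ⁻¹' {w | f w = a}) =
      P.μ (P.queries θ ⁻¹' {q}) * ENNReal.ofReal (unifProb f a) := by
  have h := (P.indep_Q θ).measure_inter_preimage_eq_mul {w | f w = a} {q}
    (Set.toFinite _).measurableSet (measurableSet_singleton q)
  rw [measure_W_eq] at h
  rw [Set.inter_comm, mul_comm]
  exact h

lemma lintegral_queries (θ : Fin K) (g : (Fin N → P.Query) → ℝ≥0∞) :
    ∫⁻ ω, g (P.queries θ ω) ∂P.μ = ∑' q, P.μ (P.queries θ ⁻¹' {q}) * g q := by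
  rw [← lintegral_map (f := g) (.of_discrete) (P.measurable_queries θ), lintegral_countable']
  refine tsum_congr fun q => ?_
  rw [Measure.map_apply (P.measurable_queries θ) (measurableSet_singleton q), mul_comm]

/-- The law of an answer is the mixture over the query of its laws for fixed queries. -/
lemma measure_A_eq (θ : Fin K) (n : Fin N) (a : P.Answer) :
    P.μ (P.A θ n ⁻¹' {a}) =
      ∫⁻ ω, ENNReal.ofReal (unifProb (P.resp n (P.Q θ n ω)) a) ∂P.μ := by
  refine Eq.trans ?_ (P.lintegral_queries θ fun q =>
    ENNReal.ofReal (unifProb (P.resp n (q n)) a)).symm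
  have h : P.A θ n ⁻¹' {a} =
      ⋃ q, P.queries θ ⁻¹' {q} ∩ P.W ⁻¹' {w | P.resp n (q n) w = a} := by
    ext ω
    simp only [Set.mem_preimage, Set.mem_singleton_iff, Set.mem_iUnion, Set.mem_inter_iff,
      Set.mem_ofPred_eq, exists_eq_left']
    rfl
  rw [h, measure_iUnion]
  · exact tsum_congr fun q => P.measure_queries_inter θ q _ a
  · intro q q' hq
    exact Disjoint.mono Set.inter_subset_left Set.inter_subset_left
      (Disjoint.preimage _ (by simpa using hq))
  · exact fun q => (P.measurable_queries θ (measurableSet_singleton q)).inter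
      (P.measurable_W (Set.toFinite _).measurableSet)

lemma measureReal_A_eq (θ : Fin K) (n : Fin N) (a : P.Answer) :
    P.μ.real (P.A θ n ⁻¹' {a}) = ∫ ω, unifProb (P.resp n (P.Q θ n ω)) a ∂P.μ := by
  rw [Measure.real, measure_A_eq, integral_eq_lintegral_of_nonneg_ae
    (ae_of_all _ fun ω => unifProb_nonneg _ _)]
  exact ((Measurable.of_discrete (f := fun x => unifProb (P.resp n x) a)).comp
    (P.measurable_Q θ n)).aestronglyMeasurable

lemma measurable_comp_queries {β : Type*} [MeasurableSpace β] (θ : Fin K)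
    (g : (Fin N → P.Query) → β) : Measurable fun ω => g (P.queries θ ω) :=
  Measurable.of_discrete.comp (P.measurable_queries θ)

lemma measurable_comp_Q {β : Type*} [MeasurableSpace β] (θ : Fin K) (n : Fin N)
    (g : P.Query → β) : Measurable fun ω => g (P.Q θ n ω) :=
  Measurable.of_discrete.comp (P.measurable_Q θ n)

/-- Conditioning on the query does not increase the entropy of an answer, `H(A | Q) ≤ H(A)`; this is
Jensen's inequality for `-x log x`. -/
lemma lintegral_unifEntropy_resp_le (θ : Fin K) (n : Fin N) :
    ∫⁻ ω, ENNReal.ofReal (unifEntropy (P.resp n (P.Q θ n ω))) ∂P.μ ≤ entropy P.μ (P.A θ n) := by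
  have hlog : 0 ≤ Real.log 2 := Real.log_nonneg (by norm_num)
  simp_rw [← tsum_negMulLog_unifProb]
  rw [lintegral_tsum fun a => (P.measurable_comp_Q θ n fun x => ENNReal.ofReal
    (Real.negMulLog (unifProb (P.resp n x) a) / Real.log 2)).aemeasurable]
  refine ENNReal.tsum_le_tsum fun a => ?_
  have hnn : ∀ ω, 0 ≤ Real.negMulLog (unifProb (P.resp n (P.Q θ n ω)) a) := fun ω =>
    Real.negMulLog_nonneg (unifProb_nonneg _ _) (unifProb_le_one _ _)
  have hint : Integrable (fun ω => unifProb (P.resp n (P.Q θ n ω)) a) P.μ :=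
    .of_bound (P.measurable_comp_Q θ n fun x => unifProb (P.resp n x) a).aestronglyMeasurable 1
      (ae_of_all _ fun ω => by
        rw [Real.norm_of_nonneg (unifProb_nonneg _ _)]; exact unifProb_le_one _ _)
  have hint' : Integrable (fun ω => Real.negMulLog (unifProb (P.resp n (P.Q θ n ω)) a)) P.μ :=
    .of_bound (P.measurable_comp_Q θ n fun x =>
      Real.negMulLog (unifProb (P.resp n x) a)).aestronglyMeasurable 1
      (ae_of_all _ fun ω => by
        rw [Real.norm_of_nonneg (hnn ω)]
        have := Real.negMulLog_le_one_sub_self (unifProb_nonneg (P.resp n (P.Q θ n ω)) a)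
        linarith [unifProb_nonneg (P.resp n (P.Q θ n ω)) a])
  rw [← ofReal_integral_eq_lintegral_ofReal (hint'.div_const _)
    (ae_of_all _ fun ω => div_nonneg (hnn ω) hlog), integral_div, measureReal_A_eq]
  gcongr
  exact Real.concaveOn_negMulLog.le_map_integral Real.continuous_negMulLog.continuousOn
    isClosed_Ici (ae_of_all _ fun ω => unifProb_nonneg _ _) hint hint'

/-- The equivocation is the mean over the query vector of conditional entropies on the finite
space of all files. -/
lemma equivocation_eq (θ : Fin K) :
    P.equivocation θ = ∫⁻ ω, ENNReal.ofReal
      (unifCondEntropy (fun w : Fin K → Fin L → Bool => w θ) (P.respAll (P.queries θ ω))) ∂P.μ := by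
  rw [P.lintegral_queries θ fun q => ENNReal.ofReal (unifCondEntropy _ (P.respAll q)), equivocation,
    condEntropy]
  set Y : P.Ω → (Fin N → P.Query) × (Fin N → P.Answer) := fun ω =>
    ((fun n => P.Q θ n ω), (fun n => P.A θ n ω)) with hY
  refine (ENNReal.tsum_prod (f := fun q a => P.μ (Y ⁻¹' {(q, a)}) *
    entropy (ProbabilityTheory.cond P.μ (Y ⁻¹' {(q, a)})) fun ω => P.W ω θ)).trans ?_
  refine tsum_congr fun q => ?_
  rw [← tsum_unifProb_mul_entropy, ← ENNReal.tsum_mul_left]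
  refine tsum_congr fun a => ?_
  have hE : Y ⁻¹' {(q, a)} =
      P.queries θ ⁻¹' {q} ∩ P.W ⁻¹' {w | P.respAll q w = a} := by
    ext ω
    simp only [hY, Set.mem_preimage, Set.mem_singleton_iff, Prod.mk.injEq, Set.mem_inter_iff,
      Set.mem_ofPred_eq]
    refine and_congr_right fun h => ?_
    subst h
    rfl
  rw [hE, measure_queries_inter, ← mul_assoc]
  by_cases h0 : P.μ (P.queries θ ⁻¹' {q}) * ENNReal.ofReal (unifProb (P.respAll q) a) = 0
  · rw [h0, zero_mul, zero_mul]
  congr 1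
  unfold entropy
  refine tsum_congr fun x => ?_
  congr 3
  have hmeas : MeasurableSet (P.queries θ ⁻¹' {q} ∩ P.W ⁻¹' {w | P.respAll q w = a}) :=
    (P.measurable_queries θ (measurableSet_singleton q)).inter
      (P.measurable_W (Set.toFinite _).measurableSet)
  have hI : P.queries θ ⁻¹' {q} ∩ P.W ⁻¹' {w | P.respAll q w = a} ∩ (fun ω => P.W ω θ) ⁻¹' {x} =
      P.queries θ ⁻¹' {q} ∩ P.W ⁻¹' {w | (w θ, P.respAll q w) = (x, a)} := by
    ext ω
    simp only [Set.mem_inter_iff, Set.mem_preimage, Set.mem_singleton_iff, Set.mem_ofPred_eq,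
      Prod.mk.injEq]
    tauto
  rw [measureReal_def, cond_apply hmeas, hI, P.measure_queries_inter, P.measure_queries_inter,
    ENNReal.toReal_mul, ENNReal.toReal_inv, ENNReal.toReal_mul, ENNReal.toReal_mul,
    ENNReal.toReal_ofReal (unifProb_nonneg _ _), ENNReal.toReal_ofReal (unifProb_nonneg _ _)]
  have hq : (P.μ (P.queries θ ⁻¹' {q})).toReal ≠ 0 :=
    ENNReal.toReal_ne_zero.2 ⟨left_ne_zero_of_mul h0, measure_ne_top _ _⟩
  field_simp

/-- For a finite query alphabet, `H(A) ≤ H(A | Q) + H(Q)`, where `H(Q)` is bounded crudely by a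
constant that does not depend on the file size. -/
lemma entropy_A_le [Fintype P.Query] (θ : Fin K) (n : Fin N) :
    entropy P.μ (P.A θ n) ≤ ENNReal.ofReal (Fintype.card P.Query / Real.log 2) +
      ∫⁻ ω, ENNReal.ofReal (unifEntropy (P.resp n (P.Q θ n ω))) ∂P.μ := by
  have hlog : 0 ≤ Real.log 2 := Real.log_nonneg (by norm_num)
  set p : P.Query → ℝ := fun x => P.μ.real (P.Q θ n ⁻¹' {x}) with hp
  have hp0 : ∀ x, 0 ≤ p x := fun x => measureReal_nonneg
  have hp1 : ∀ x, p x ≤ 1 := fun x => measureReal_le_one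
  have hlint : ∀ g : P.Query → ℝ≥0∞, ∫⁻ ω, g (P.Q θ n ω) ∂P.μ = ∑ x, ENNReal.ofReal (p x) * g x := by
    intro g
    rw [← lintegral_map (f := g) (.of_discrete) (P.measurable_Q θ n), lintegral_fintype]
    refine Finset.sum_congr rfl fun x _ => ?_
    rw [Measure.map_apply (P.measurable_Q θ n) (measurableSet_singleton x), mul_comm, hp,
      ofReal_measureReal]
  have hA : ∀ a, P.μ.real (P.A θ n ⁻¹' {a}) = ∑ x, p x * unifProb (P.resp n x) a := by
    intro a
    rw [Measure.real, measure_A_eq,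
      hlint fun x => ENNReal.ofReal (unifProb (P.resp n x) a), ENNReal.toReal_sum (by finiteness)]
    refine Finset.sum_congr rfl fun x _ => ?_
    rw [ENNReal.toReal_mul, ENNReal.toReal_ofReal (hp0 x),
      ENNReal.toReal_ofReal (unifProb_nonneg _ _)]
  have tsum_prob : ∀ x, ∑' a, ENNReal.ofReal (unifProb (P.resp n x) a) = 1 := by
    classical
    intro x
    rw [tsum_eq_sum (s := Finset.univ.image (P.resp n x)), ← ENNReal.ofReal_sum_of_nonneg
      fun _ _ => unifProb_nonneg _ _, sum_unifProb_eq _ _ (by simp), ENNReal.ofReal_one]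
    intro a ha
    rw [unifProb_eq_zero fun w hw => ha (by simp [← hw]), ENNReal.ofReal_zero]
  calc entropy P.μ (P.A θ n)
      ≤ ∑' a, ∑ x, (ENNReal.ofReal (1 / Real.log 2) * ENNReal.ofReal (unifProb (P.resp n x) a) +
          ENNReal.ofReal (p x) *
            ENNReal.ofReal (Real.negMulLog (unifProb (P.resp n x) a) / Real.log 2)) := by
        refine ENNReal.tsum_le_tsum fun a => ?_
        have h1 : ∀ x, ENNReal.ofReal (1 / Real.log 2) * ENNReal.ofReal (unifProb (P.resp n x) a) +
            ENNReal.ofReal (p x) *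
              ENNReal.ofReal (Real.negMulLog (unifProb (P.resp n x) a) / Real.log 2) =
            ENNReal.ofReal ((unifProb (P.resp n x) a +
              p x * Real.negMulLog (unifProb (P.resp n x) a)) / Real.log 2) := by
          intro x
          rw [← ENNReal.ofReal_mul (by positivity), ← ENNReal.ofReal_mul (hp0 x),
            ← ENNReal.ofReal_add]
          · congr 1; ring
          · exact mul_nonneg (by positivity) (unifProb_nonneg _ _)
          · exact mul_nonneg (hp0 x) (div_nonneg
              (Real.negMulLog_nonneg (unifProb_nonneg _ _) (unifProb_le_one _ _)) hlog)
        rw [Finset.sum_congr rfl fun x _ => h1 x, ← ENNReal.ofReal_sum_of_nonneg fun x _ =>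
          div_nonneg (add_nonneg (unifProb_nonneg _ _) (mul_nonneg (hp0 x)
            (Real.negMulLog_nonneg (unifProb_nonneg _ _) (unifProb_le_one _ _)))) hlog,
          ← Finset.sum_div, hA]
        gcongr
        refine (negMulLog_sum_le _ _ fun x _ => mul_nonneg (hp0 x) (unifProb_nonneg _ _)).trans ?_
        refine Finset.sum_le_sum fun x _ => ?_
        rw [Real.negMulLog_mul]
        gcongr
        refine mul_le_of_le_one_right (unifProb_nonneg _ _) ?_
        linarith [Real.negMulLog_le_one_sub_self (hp0 x), hp0 x]
    _ = ENNReal.ofReal (Fintype.card P.Query / Real.log 2) +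
      ∫⁻ ω, ENNReal.ofReal (unifEntropy (P.resp n (P.Q θ n ω))) ∂P.μ := by
        rw [hlint fun x => ENNReal.ofReal (unifEntropy (P.resp n x)),
          Summable.tsum_finsetSum fun _ _ => ENNReal.summable]
        simp_rw [ENNReal.tsum_add, ENNReal.tsum_mul_left, tsum_prob, tsum_negMulLog_unifProb]
        rw [Finset.sum_add_distrib]
        congr 1
        rw [Finset.sum_const, mul_one, nsmul_eq_mul, Finset.card_univ, ← ENNReal.ofReal_natCast,
          ← ENNReal.ofReal_mul (by positivity), mul_one_div]

end Scheme

/-! ### The converse for a single scheme -/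

lemma sum_erase_powerset {ι : Type*} [DecidableEq ι] (T : Finset ι) (x : Finset ι → ℝ) :
    ∑ n ∈ T, ∑ S ∈ (T.erase n).powerset, x S =
      ∑ S ∈ T.powerset, ((T.card : ℝ) - S.card) * x S := by
  have h : ∀ n ∈ T, ∑ S ∈ (T.erase n).powerset, x S =
      ∑ S ∈ T.powerset, if n ∉ S then x S else 0 := by
    intro n _
    rw [← Finset.sum_filter]
    refine Finset.sum_congr ?_ fun _ _ => rfl
    ext S
    simp [Finset.subset_erase]
  rw [Finset.sum_congr rfl h, Finset.sum_comm]
  refine Finset.sum_congr rfl fun S hS => ?_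
  rw [← Finset.sum_filter, Finset.sum_const, nsmul_eq_mul, Finset.filter_notMem_eq_sdiff,
    Finset.card_sdiff_of_subset (Finset.mem_powerset.1 hS),
    Nat.cast_sub (Finset.card_le_card (Finset.mem_powerset.1 hS))]

namespace Scheme

variable {N : ℕ} {m : Fin N → ℝ} {K L : ℕ} (P : Scheme m K L)

/-- The positions of the bits that belong to a file in `J` or are stored in a database outside
`T`. -/
def known (J : Finset (Fin K)) (T : Finset (Fin N)) : Finset (Fin K × Fin L) :=
  Finset.univ.filter fun p => p.1 ∈ J ∨ ¬ P.placement p ⊆ T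

/-- `|W_{k,S}|`, the number of bits of the `k`-th file that are placed exactly in `S`. -/
def fileSize (k : Fin K) (S : Finset (Fin N)) : ℕ :=
  (Finset.univ.filter fun i : Fin L => P.placement (k, i) = S).card

/-- `H(A_T^{[θ]} | Q^{[θ]}, W_J, Z_{Tᶜ})`: what the answers of the databases in `T` reveal beyond
the files in `J` and the contents of all the other databases. -/
def residual (θ : Fin K) (T : Finset (Fin N)) (J : Finset (Fin K)) : ℝ :=
  ∫ ω, unifCondEntropy (fun w (n : T) => P.resp n (P.Q θ n ω) w) (bitsAt (P.known J T)) ∂P.μ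

/-- `H(A_n^{[θ]} | Q_n^{[θ]}, bits in B)`. -/
def single (θ : Fin K) (n : Fin N) (B : Finset (Fin K × Fin L)) : ℝ :=
  ∫ ω, unifCondEntropy (P.resp n (P.Q θ n ω)) (bitsAt B) ∂P.μ

lemma integrable_unifCondEntropy {α γ : Type*} (θ : Fin K)
    (F : (Fin N → P.Query) → (Fin K → Fin L → Bool) → α)
    (C : (Fin N → P.Query) → (Fin K → Fin L → Bool) → γ) :
    Integrable (fun ω => unifCondEntropy (F (P.queries θ ω)) (C (P.queries θ ω))) P.μ :=
  .of_bound (P.measurable_comp_queries θ fun q =>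
    unifCondEntropy (F q) (C q)).aestronglyMeasurable
    (Real.logb 2 (Fintype.card (Fin K → Fin L → Bool))) (ae_of_all _ fun ω => by
      rw [Real.norm_of_nonneg (unifCondEntropy_nonneg _ _)]
      exact unifCondEntropy_le_logb_card _ _)

lemma integrable_residual (θ : Fin K) (T : Finset (Fin N)) (B : Finset (Fin K × Fin L)) :
    Integrable (fun ω => unifCondEntropy (fun w (n : T) => P.resp n (P.Q θ n ω) w) (bitsAt B))
      P.μ :=
  P.integrable_unifCondEntropy θ (fun q w (n : T) => P.resp n (q n) w) fun _ => bitsAt B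

lemma integrable_single (θ : Fin K) (n : Fin N) (B : Finset (Fin K × Fin L)) :
    Integrable (fun ω => unifCondEntropy (P.resp n (P.Q θ n ω)) (bitsAt B)) P.μ :=
  P.integrable_unifCondEntropy θ (fun q => P.resp n (q n)) fun _ => bitsAt B

lemma integrable_equivocation (θ : Fin K) :
    Integrable (fun ω => unifCondEntropy (fun w : Fin K → Fin L → Bool => w θ)
      (P.respAll (P.queries θ ω))) P.μ :=
  P.integrable_unifCondEntropy θ (fun _ w => w θ) P.respAll

lemma equivocation_eq_ofReal (θ : Fin K) :
    P.equivocation θ = ENNReal.ofReal (∫ ω, unifCondEntropy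
      (fun w : Fin K → Fin L → Bool => w θ) (P.respAll (P.queries θ ω)) ∂P.μ) := by
  rw [P.equivocation_eq, ofReal_integral_eq_lintegral_ofReal (P.integrable_equivocation θ)
    (ae_of_all _ fun ω => unifCondEntropy_nonneg _ _)]

lemma toReal_equivocation (θ : Fin K) :
    (P.equivocation θ).toReal = ∫ ω, unifCondEntropy
      (fun w : Fin K → Fin L → Bool => w θ) (P.respAll (P.queries θ ω)) ∂P.μ := by
  rw [P.equivocation_eq_ofReal, ENNReal.toReal_ofReal]
  exact integral_nonneg fun ω => unifCondEntropy_nonneg _ _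

/-- The only use of privacy in the converse: the law of a single query does not depend on the
desired file. -/
lemma single_eq (θ θ' : Fin K) (n : Fin N) (B : Finset (Fin K × Fin L)) :
    P.single θ n B = P.single θ' n B := by
  have h := (P.privacy n θ θ').comp (u := fun x => unifCondEntropy (P.resp n x.1) (bitsAt B))
    (.of_discrete)
  exact h.integral_eq

lemma resp_eq_of_agree (n : Fin N) (x : P.Query) {w w' : Fin K → Fin L → Bool}
    (h : ∀ p, n ∈ P.placement p → w p.1 p.2 = w' p.1 p.2) : P.resp n x w = P.resp n x w' := by
  unfold resp
  congr 1
  funext p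
  exact h p.1 p.2

/-- Reveal the answer of database `n` and then its whole content. -/
lemma single_add_residual_erase_le (θ : Fin K) (J : Finset (Fin K)) {T : Finset (Fin N)}
    {n : Fin N} (hn : n ∈ T) :
    P.single θ n (P.known J T) + P.residual θ (T.erase n) J ≤ P.residual θ T J := by
  unfold single residual
  rw [← integral_add (P.integrable_single θ n _) (P.integrable_residual θ _ _)]
  refine integral_mono ((P.integrable_single θ n _).add (P.integrable_residual θ _ _))
    (P.integrable_residual θ _ _) fun ω => ?_
  calc _ ≤ unifCondEntropy (P.resp n (P.Q θ n ω)) (bitsAt (P.known J T)) +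
        unifCondEntropy (fun w (n : (T.erase n : Finset _)) => P.resp n (P.Q θ n ω) w)
          (fun w => (P.resp n (P.Q θ n ω) w, bitsAt (P.known J T) w)) := by
        refine add_le_add le_rfl (unifCondEntropy_anti fun w w' h => ?_)
        rw [bitsAt_eq_iff] at h
        refine Prod.ext (P.resp_eq_of_agree n _ fun p hp => h p ?_) (bitsAt_eq_iff.2 fun p hp =>
          h p ?_)
        · simp only [known, Finset.mem_filter, Finset.mem_univ, true_and]
          exact Or.inr fun hsub => by simpa using hsub hp
        · simp only [known, Finset.mem_filter, Finset.mem_univ, true_and] at hp ⊢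
          exact hp.imp_right fun hT hsub => hT (hsub.trans (Finset.erase_subset _ _))
    _ = unifCondEntropy (fun w => (P.resp n (P.Q θ n ω) w,
          fun n : (T.erase n : Finset _) => P.resp n (P.Q θ n ω) w)) (bitsAt (P.known J T)) :=
        (unifCondEntropy_chain _ _ _).symm
    _ ≤ _ := by
        refine unifCondEntropy_mono fun w w' h _ => ?_
        refine Prod.ext (congrFun h ⟨n, hn⟩) (funext fun i => congrFun h
          ⟨i.1, Finset.mem_of_mem_erase i.2⟩)

/-- Subadditivity, followed by an exchange of the desired file, which privacy permits for one answer
at a time. -/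
lemma residual_le_sum_single (θ θ' : Fin K) (T : Finset (Fin N)) (J : Finset (Fin K)) :
    P.residual θ T J ≤ ∑ n ∈ T, P.single θ' n (P.known J T) := by
  rw [Finset.sum_congr rfl fun n _ => P.single_eq θ' θ n _]
  unfold single residual
  rw [← integral_finsetSum _ fun n _ => P.integrable_single θ n _]
  exact integral_mono (P.integrable_residual θ _ _)
    (integrable_finsetSum _ fun n _ => P.integrable_single θ n _) fun ω =>
      unifCondEntropy_finset_le_sum (fun n => P.resp n (P.Q θ n ω)) _ T

/-- Decoding: up to the equivocation, the answers of `T` and the contents of the other databases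
determine the file `k`, whose bits placed inside `T` were unknown. -/
lemma fileSize_add_residual_insert_le (k : Fin K) (J : Finset (Fin K)) (hk : k ∉ J)
    (T : Finset (Fin N)) :
    ∑ S ∈ T.powerset, (P.fileSize k S : ℝ) + P.residual k T (insert k J) ≤
      P.residual k T J + (P.equivocation k).toReal := by
  classical
  rw [toReal_equivocation]
  unfold residual
  rw [← integral_add (P.integrable_residual k _ _) (P.integrable_equivocation k)]
  have h0 : ∑ S ∈ T.powerset, (P.fileSize k S : ℝ) = ∫ _, (∑ S ∈ T.powerset,
      (P.fileSize k S : ℝ)) ∂P.μ := by simp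
  rw [h0, ← integral_add (integrable_const _) (P.integrable_residual k _ _)]
  refine integral_mono ((integrable_const _).add (P.integrable_residual k _ _))
    ((P.integrable_residual k _ _).add (P.integrable_equivocation k)) fun ω => ?_
  set F : Finset (Fin K × Fin L) := Finset.univ.filter fun p => p.1 = k with hF
  set c := bitsAt (P.known J T)
  set f : (Fin K → Fin L → Bool) → T → P.Answer := fun w n => P.resp n (P.Q k n ω) w
  have h1 : ∑ S ∈ T.powerset, (P.fileSize k S : ℝ) = unifCondEntropy (bitsAt F) c := by
    rw [unifCondEntropy_bitsAt, ← Nat.cast_sum]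
    congr 1
    have : F \ P.known J T = (Finset.univ.filter fun i : Fin L => P.placement (k, i) ⊆ T).map
        ⟨fun i => (k, i), fun _ _ h => (Prod.ext_iff.1 h).2⟩ := by
      ext ⟨k', i⟩
      simp only [hF, known, Finset.mem_sdiff, Finset.mem_filter, Finset.mem_univ, true_and,
        not_or, not_not, Finset.mem_map]
      constructor
      · rintro ⟨rfl, -, h⟩
        exact ⟨i, h, rfl⟩
      · rintro ⟨i', h, hi⟩
        obtain ⟨rfl, rfl⟩ : k = k' ∧ i' = i := Prod.ext_iff.1 hi
        exact ⟨rfl, hk, h⟩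
    rw [this, Finset.card_map, Finset.card_eq_sum_card_fiberwise (f := fun i => P.placement (k, i))
      (t := T.powerset) fun i hi => by simpa using hi]
    refine Finset.sum_congr rfl fun S hS => ?_
    rw [fileSize, Finset.filter_filter]
    congr 1
    ext i
    simp only [Finset.mem_filter, Finset.mem_univ, true_and]
    exact ⟨fun h => ⟨h ▸ Finset.mem_powerset.1 hS, h⟩, fun h => h.2⟩
  have h2 : unifCondEntropy f (bitsAt (P.known (insert k J) T)) =
      unifCondEntropy f (fun w => (bitsAt F w, c w)) := by
    refine unifCondEntropy_congr_right fun w w' => ?_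
    simp only [Prod.mk.injEq, c, bitsAt_eq_iff, hF, known, Finset.mem_filter, Finset.mem_univ,
      true_and, Finset.mem_insert]
    constructor
    · intro h
      exact ⟨fun p hp => h p (Or.inl (Or.inl hp)), fun p hp => h p (hp.imp_left Or.inr)⟩
    · rintro ⟨h, h'⟩ p ((hp | hp) | hp)
      · exact h p hp
      · exact h' p (Or.inl hp)
      · exact h' p (Or.inr hp)
  have h3 : unifCondEntropy (bitsAt F) (fun w => (f w, c w)) ≤
      unifCondEntropy (fun w : Fin K → Fin L → Bool => w k) (P.respAll (P.queries k ω)) := by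
    refine (unifCondEntropy_mono (g := fun w : Fin K → Fin L → Bool => w k) fun w w' h _ => ?_).trans
      (unifCondEntropy_anti fun w w' h => ?_)
    · rw [bitsAt_eq_iff]
      rintro ⟨k', i⟩ hp
      simp only [hF, Finset.mem_filter, Finset.mem_univ, true_and] at hp
      subst hp
      exact congrFun h i
    · obtain ⟨hf, hc⟩ := Prod.ext_iff.1 h
      funext n
      by_cases hn : n ∈ T
      · exact congrFun hf ⟨n, hn⟩
      · refine P.resp_eq_of_agree n _ fun p hp => bitsAt_eq_iff.1 hc p ?_
        simp only [known, Finset.mem_filter, Finset.mem_univ, true_and]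
        exact Or.inr fun hsub => hn (hsub hp)
  have h4 := unifCondEntropy_chain f (bitsAt F) c
  have h5 := unifCondEntropy_chain' f (bitsAt F) c
  simp only [h1, h2]
  linarith

/-- The set-weights `∑_{i < r} |W_{o i, S}| / |S|^{i + 1}` of the nested lower bound; `S = ∅` gets
weight `0` by the convention `x / 0 = 0`. -/
def weight (o : ℕ → Fin K) (r : ℕ) (S : Finset (Fin N)) : ℝ :=
  ∑ i ∈ Finset.range r, (P.fileSize (o i) S : ℝ) / (S.card : ℝ) ^ (i + 1)

lemma weight_nonneg (o : ℕ → Fin K) (r : ℕ) (S : Finset (Fin N)) : 0 ≤ P.weight o r S :=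
  Finset.sum_nonneg fun _ _ => by positivity

lemma card_mul_weight_succ_le (o : ℕ → Fin K) (r : ℕ) (S : Finset (Fin N)) :
    S.card * P.weight o (r + 1) S ≤
      P.fileSize (o 0) S + P.weight (fun i => o (i + 1)) r S := by
  have h : P.weight o (r + 1) S =
      (P.fileSize (o 0) S + P.weight (fun i => o (i + 1)) r S) / S.card := by
    rw [weight, Finset.sum_range_succ', weight, add_div, Finset.sum_div, add_comm]
    congr 1
    · simp
    · exact Finset.sum_congr rfl fun i _ => by rw [pow_succ _ (i + 1), div_div]
  rw [h]
  rcases Nat.eq_zero_or_pos S.card with h0 | h0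
  · have := P.weight_nonneg (fun i => o (i + 1)) r S
    simp only [h0, Nat.cast_zero, zero_mul]
    positivity
  · have : (S.card : ℝ) ≠ 0 := by exact_mod_cast h0.ne'
    exact (mul_div_cancel₀ _ this).le

/-- The nested lower bound. Averaging `single_add_residual_erase_le` over `n ∈ T` bounds
`|T| H(A_T | …)` below by `∑_{n ∈ T} H(A_n | …)`, which privacy and subadditivity turn into the
residual of `A_T^{[o 0]}`, plus the residuals of the sets `T \ {n}`; a set `S ⊆ T` survives in
`|T| - |S|` of the latter, which is exactly what makes the weights `1 / |S|` work. -/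
lemma sum_weight_le_residual {E : ℝ} (hE : ∀ k, (P.equivocation k).toReal ≤ E) (r : ℕ) :
    ∀ (o : ℕ → Fin K) (J : Finset (Fin K)), (∀ i < r, ∀ j < r, o i = o j → i = j) →
      (∀ i < r, o i ∉ J) → ∀ (θ : Fin K) (T : Finset (Fin N)),
      ∑ S ∈ T.powerset, P.weight o r S - r * T.card * E ≤ P.residual θ T J := by
  have residual_nonneg : ∀ θ T J, 0 ≤ P.residual θ T J := fun θ T J =>
    integral_nonneg fun ω => unifCondEntropy_nonneg _ _
  induction r with
  | zero => intro o J _ _ θ T; simpa [weight] using residual_nonneg θ T J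
  | succ r ih =>
    intro o J ho hJ θ T
    have hE0 : 0 ≤ E := ENNReal.toReal_nonneg.trans (hE θ)
    induction T using Finset.strongInduction with
    | H T ihT =>
    rcases T.eq_empty_or_nonempty with rfl | hT
    · simpa [weight] using residual_nonneg θ ∅ J
    have ht : (1 : ℝ) ≤ T.card := by exact_mod_cast hT.card_pos
    have h1 : ∑ n ∈ T, (P.single θ n (P.known J T) + P.residual θ (T.erase n) J) ≤
        T.card * P.residual θ T J := by
      rw [← nsmul_eq_mul, ← Finset.sum_const]
      exact Finset.sum_le_sum fun n hn => P.single_add_residual_erase_le θ J hn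
    rw [Finset.sum_add_distrib] at h1
    have h2 := P.residual_le_sum_single (o 0) θ T J
    have h3 := P.fileSize_add_residual_insert_le (o 0) J (hJ 0 (by omega)) T
    have h4 := ih (fun i => o (i + 1)) (insert (o 0) J)
      (fun i hi j hj h => by have := ho _ (by omega) _ (by omega) h; omega)
      (fun i hi h => by
        rcases Finset.mem_insert.1 h with h | h
        · have := ho _ (by omega) _ (by omega) h; omega
        · exact hJ _ (by omega) h) (o 0) T
    have h5 : ∑ n ∈ T, (∑ S ∈ (T.erase n).powerset, P.weight o (r + 1) S -
        (r + 1 : ℕ) * ((T.card : ℝ) - 1) * E) ≤ ∑ n ∈ T, P.residual θ (T.erase n) J := by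
      refine Finset.sum_le_sum fun n hn => ?_
      have := ihT (T.erase n) (Finset.erase_ssubset hn)
      rwa [Finset.card_erase_of_mem hn, Nat.cast_sub hT.card_pos, Nat.cast_one] at this
    rw [Finset.sum_sub_distrib, sum_erase_powerset, Finset.sum_const, nsmul_eq_mul] at h5
    have h6 : ∑ S ∈ T.powerset, (S.card : ℝ) * P.weight o (r + 1) S ≤
        ∑ S ∈ T.powerset, (P.fileSize (o 0) S : ℝ) +
          ∑ S ∈ T.powerset, P.weight (fun i => o (i + 1)) r S := by
      rw [← Finset.sum_add_distrib]
      exact Finset.sum_le_sum fun S _ => P.card_mul_weight_succ_le o r S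
    have h7 : ∑ S ∈ T.powerset, ((T.card : ℝ) - S.card) * P.weight o (r + 1) S =
        T.card * ∑ S ∈ T.powerset, P.weight o (r + 1) S -
          ∑ S ∈ T.powerset, (S.card : ℝ) * P.weight o (r + 1) S := by
      rw [Finset.mul_sum, ← Finset.sum_sub_distrib]
      exact Finset.sum_congr rfl fun S _ => by ring
    have h8 := hE (o 0)
    refine le_of_mul_le_mul_left ?_ (by linarith : (0 : ℝ) < T.card)
    push_cast at h5 ⊢
    -- With `t = |T|` the error terms require `1 + r t + (r + 1) t (t - 1) ≤ (r + 1) t²`, i.e. `1 ≤ t`.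
    have h9 : 0 ≤ ((T.card : ℝ) - 1) * E := mul_nonneg (by linarith) hE0
    nlinarith

/-- The lower bound on the download cost for one desired file and one ordering `o` of the files
that starts with it. -/
lemma le_downloadCost {E : ℝ} (hE : ∀ k, (P.equivocation k).toReal ≤ E) (o : ℕ → Fin K)
    (ho : ∀ i < K, ∀ j < K, o i = o j → i = j) :
    ENNReal.ofReal (∑ S : Finset (Fin N), ∑ i ∈ Finset.range K,
      (P.fileSize (o i) S : ℝ) / (S.card : ℝ) ^ i - (1 + K * N) * E) ≤ P.downloadCost (o 0) := by
  have hE0 : 0 ≤ E := ENNReal.toReal_nonneg.trans (hE (o 0))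
  obtain ⟨r, rfl⟩ : ∃ r, K = r + 1 := Nat.exists_eq_succ_of_ne_zero (o 0).pos.ne'
  have h1 : ENNReal.ofReal (∑ n, P.single (o 0) n (P.known ∅ Finset.univ)) ≤
      P.downloadCost (o 0) := by
    rw [ENNReal.ofReal_sum_of_nonneg fun n _ => show 0 ≤ P.single (o 0) n _ from
      integral_nonneg fun ω => unifCondEntropy_nonneg _ _]
    refine Finset.sum_le_sum fun n _ => ?_
    refine le_trans ?_ (P.lintegral_unifEntropy_resp_le (o 0) n)
    rw [single, ofReal_integral_eq_lintegral_ofReal (P.integrable_single (o 0) n _)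
      (ae_of_all _ fun ω => unifCondEntropy_nonneg _ _)]
    exact lintegral_mono fun ω => ENNReal.ofReal_le_ofReal (unifCondEntropy_le_unifEntropy _ _)
  refine le_trans (ENNReal.ofReal_le_ofReal ?_) h1
  have h2 := P.residual_le_sum_single (o 0) (o 0) Finset.univ ∅
  have h3 := P.fileSize_add_residual_insert_le (o 0) ∅ (by simp) Finset.univ
  have h4 := P.sum_weight_le_residual hE r (fun i => o (i + 1)) {o 0}
    (fun i hi j hj h => by have := ho _ (by omega) _ (by omega) h; omega)
    (fun i hi h => by
      have := ho _ (by omega) _ (by omega) (Finset.mem_singleton.1 h); omega) (o 0) Finset.univ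
  have h5 := hE (o 0)
  rw [Finset.powerset_univ] at h3 h4
  rw [Finset.card_univ, Fintype.card_fin] at h4
  have h6 : ∑ S : Finset (Fin N), ∑ i ∈ Finset.range (r + 1),
      (P.fileSize (o i) S : ℝ) / (S.card : ℝ) ^ i = ∑ S : Finset (Fin N),
        (P.fileSize (o 0) S : ℝ) + ∑ S : Finset (Fin N), P.weight (fun i => o (i + 1)) r S := by
    rw [← Finset.sum_add_distrib]
    refine Finset.sum_congr rfl fun S _ => ?_
    rw [Finset.sum_range_succ', weight, add_comm]
    simp
  simp only [insert_empty_eq] at h3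
  have h7 : (0 : ℝ) ≤ N * E := by positivity
  push_cast
  rw [h6]
  nlinarith

end Scheme

/-! ### From schemes to feasible points of the linear program -/

section LinearProgram

variable {N : ℕ}

lemma objective_eq (K : ℕ) (α : Finset (Fin N) → ℝ) :
    objective K α = ∑ S : Finset (Fin N) with 1 ≤ S.card,
      α S * ∑ i ∈ Finset.range K, 1 / (S.card : ℝ) ^ i := by
  rw [objective, ← Finset.sum_fiberwise_of_maps_to (s := Finset.univ.filter
    fun S : Finset (Fin N) => 1 ≤ S.card) (g := Finset.card) (t := Finset.Icc 1 N)]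
  · refine Finset.sum_congr rfl fun l hl => ?_
    rw [Finset.filter_filter]
    refine Finset.sum_congr (Finset.filter_congr fun S _ => ?_) fun S hS => ?_
    · have := Finset.mem_Icc.1 hl
      exact ⟨fun h => ⟨h ▸ this.1, h⟩, fun h => h.2⟩
    · rw [(Finset.mem_filter.1 hS).2.2]
  · intro S hS
    have := Finset.card_le_univ S
    rw [Fintype.card_fin] at this
    exact Finset.mem_Icc.2 ⟨(Finset.mem_filter.1 hS).2, this⟩

lemma continuous_objective (K : ℕ) : Continuous (objective K : (Finset (Fin N) → ℝ) → ℝ) := by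
  unfold objective
  fun_prop

end LinearProgram

namespace Scheme

variable {N : ℕ} {m : Fin N → ℝ} {K L : ℕ} (P : Scheme m K L)

/-- The fraction of all the bits that is placed exactly in `S`. -/
def share (S : Finset (Fin N)) : ℝ :=
  (∑ k, (P.fileSize k S : ℝ)) / (K * L)

lemma share_nonneg (S : Finset (Fin N)) : 0 ≤ P.share S := by
  unfold share; positivity

lemma sum_fileSize (k : Fin K) : ∑ S, P.fileSize k S = L := by
  have h := Finset.card_eq_sum_card_fiberwise (s := Finset.univ)
    (f := fun i : Fin L => P.placement (k, i)) (t := Finset.univ) fun _ _ => by simp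
  rw [Finset.card_univ, Fintype.card_fin] at h
  exact h.symm

lemma sum_share (hK : 0 < K) (hL : 0 < L) : ∑ S, P.share S = 1 := by
  have h : (0 : ℝ) < K * L := by positivity
  simp only [share]
  rw [← Finset.sum_div, Finset.sum_comm, div_eq_one_iff_eq h.ne']
  simp [← Nat.cast_sum, P.sum_fileSize]

lemma share_le_one (hK : 0 < K) (hL : 0 < L) (S : Finset (Fin N)) : P.share S ≤ 1 :=
  P.sum_share hK hL ▸ Finset.single_le_sum (fun S _ => P.share_nonneg S) (Finset.mem_univ S)

lemma sum_share_of_mem_le (hK : 0 < K) (hL : 0 < L) (n : Fin N) (hm : 0 ≤ m n) :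
    ∑ S with n ∈ S, P.share S ≤ m n := by
  have h0 : (0 : ℝ) < K * L := by positivity
  have h := P.storage n
  set B : Finset (Fin K × Fin L) := Finset.univ.filter fun p => n ∈ P.placement p with hB
  rw [entropy_content P.measurable_W P.uniform_W B _ (by simp [hB]), ← ENNReal.ofReal_natCast,
    ENNReal.ofReal_le_ofReal_iff (by positivity)] at h
  have hcard : B.card = ∑ S with n ∈ S, ∑ k, P.fileSize k S := by
    rw [Finset.card_eq_sum_card_fiberwise (f := P.placement)
      (t := Finset.univ.filter fun S => n ∈ S) fun p hp => by simpa [hB] using hp]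
    refine Finset.sum_congr rfl fun S hS => ?_
    rw [Finset.card_eq_sum_card_fiberwise (f := Prod.fst) (t := Finset.univ) fun _ _ => by simp]
    refine Finset.sum_congr rfl fun k _ => ?_
    rw [fileSize, ← Finset.card_map ⟨fun i : Fin L => (k, i), fun _ _ h => (Prod.ext_iff.1 h).2⟩]
    congr 1
    ext ⟨k', i⟩
    simp only [hB, Finset.mem_filter, Finset.mem_univ, true_and, Finset.mem_map] at hS ⊢
    constructor
    · rintro ⟨⟨-, h⟩, rfl⟩
      exact ⟨i, h, rfl⟩
    · rintro ⟨i', h, hi⟩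
      obtain ⟨rfl, rfl⟩ : k = k' ∧ i' = i := Prod.ext_iff.1 hi
      exact ⟨⟨h ▸ hS, h⟩, rfl⟩
  simp only [share]
  rw [← Finset.sum_div, div_le_iff₀ h0]
  rw [hcard] at h
  exact_mod_cast h

/-- Bits that are not stored anywhere cannot be retrieved. -/
lemma fileSize_empty_le (k : Fin K) : (P.fileSize k ∅ : ℝ) ≤ (P.equivocation k).toReal := by
  have h := P.fileSize_add_residual_insert_le k ∅ (by simp) ∅
  have h1 : 0 ≤ P.residual k ∅ (insert k ∅) := integral_nonneg fun ω => unifCondEntropy_nonneg _ _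
  have h2 : P.residual k ∅ ∅ ≤ 0 := integral_nonpos fun ω =>
    (unifCondEntropy_finset_le_sum (fun n => P.resp n (P.Q k n ω)) _ ∅).trans (by simp)
  simp only [Finset.powerset_empty, Finset.sum_singleton] at h
  linarith

lemma share_empty_le {E : ℝ} (hE : ∀ k, (P.equivocation k).toReal ≤ E) (hK : 0 < K) (hL : 0 < L) :
    P.share ∅ ≤ E / L := by
  rw [share, div_le_div_iff₀ (by positivity) (by positivity)]
  have h : ∑ k, (P.fileSize k ∅ : ℝ) ≤ K * E := by
    calc _ ≤ ∑ _k : Fin K, E := Finset.sum_le_sum fun k _ => (P.fileSize_empty_le k).trans (hE k)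
      _ = _ := by simp
  calc _ ≤ K * E * L := by gcongr
    _ = _ := by ring

/-- The shares of a scheme are nearly a witness for its download cost: average `le_downloadCost`
over the cyclic orderings of the files. -/
lemma objective_share_le {E c : ℝ} (hE : ∀ k, (P.equivocation k).toReal ≤ E) (hc : 0 ≤ c)
    (hD : ∀ θ, P.downloadCost θ ≤ ENNReal.ofReal c) (hK : 0 < K) (hL : 0 < L) :
    L * objective K P.share ≤ c + (1 + K * N) * E := by
  have hK' : (0 : ℝ) < K := by exact_mod_cast hK
  have hL' : (0 : ℝ) < L := by exact_mod_cast hL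
  -- The cyclic ordering `θ, θ + 1, …` of the files; every file occurs once in each place.
  let o : Fin K → ℕ → Fin K := fun θ i => ⟨(θ + i) % K, Nat.mod_lt _ hK⟩
  have ho0 : ∀ θ, o θ 0 = θ := fun θ => Fin.ext (by simp [o, Nat.mod_eq_of_lt θ.2])
  have ho : ∀ θ, ∀ i < K, ∀ j < K, o θ i = o θ j → i = j := fun θ i hi j hj h => by
    have : (θ + i) ≡ (θ + j) [MOD K] := Fin.ext_iff.1 h
    exact (Nat.ModEq.add_left_cancel' _ this).eq_of_lt_of_lt hi hj
  have hbij : ∀ i, Function.Bijective fun θ => o θ i := fun i =>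
    Finite.injective_iff_bijective.1 fun θ θ' h => by
      have : (θ + i) ≡ (θ' + i) [MOD K] := Fin.ext_iff.1 h
      exact Fin.ext ((Nat.ModEq.add_right_cancel' _ this).eq_of_lt_of_lt θ.2 θ'.2)
  have h1 : ∀ θ, ∑ S : Finset (Fin N), ∑ i ∈ Finset.range K,
      (P.fileSize (o θ i) S : ℝ) / (S.card : ℝ) ^ i ≤ c + (1 + K * N) * E := fun θ => by
    have h := (P.le_downloadCost hE (o θ) (ho θ)).trans (hD _)
    rw [ENNReal.ofReal_le_ofReal_iff hc] at h
    linarith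
  have h2 := Finset.sum_le_sum fun θ (_ : θ ∈ Finset.univ) => h1 θ
  rw [Finset.sum_const, Finset.card_univ, Fintype.card_fin, nsmul_eq_mul] at h2
  have h3 : ∑ θ, ∑ S : Finset (Fin N), ∑ i ∈ Finset.range K,
      (P.fileSize (o θ i) S : ℝ) / (S.card : ℝ) ^ i =
      ∑ S : Finset (Fin N), (K * L) * (P.share S * ∑ i ∈ Finset.range K, 1 / (S.card : ℝ) ^ i) := by
    rw [Finset.sum_comm]
    refine Finset.sum_congr rfl fun S _ => ?_
    rw [Finset.sum_comm, ← mul_assoc, Finset.mul_sum]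
    refine Finset.sum_congr rfl fun i _ => ?_
    rw [← Finset.sum_div, (hbij i).sum_comp fun k => (P.fileSize k S : ℝ), share]
    field_simp
  have h4 : K * (L * objective K P.share) ≤ ∑ S : Finset (Fin N),
      (K * L) * (P.share S * ∑ i ∈ Finset.range K, 1 / (S.card : ℝ) ^ i) := by
    rw [objective_eq, Finset.mul_sum, Finset.mul_sum]
    simp_rw [← mul_assoc]
    refine Finset.sum_le_sum_of_subset_of_nonneg (Finset.filter_subset _ _) fun S _ _ => ?_
    have := P.share_nonneg S
    positivity
  refine le_of_mul_le_mul_left ?_ hK'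
  linarith

end Scheme

/-- Achievable costs are at least the optimal value of the linear program: a limit point of the
shares of the schemes is feasible. -/
theorem exists_feasible_of_isAchievable {N K : ℕ} (hK : 1 ≤ K) {m : Fin N → ℝ}
    (hm : ∀ n, 0 ≤ m n) {d : ℝ≥0∞} (hd : d ≠ ⊤) (h : IsAchievable m K d) :
    ∃ α ∈ feasible m, ENNReal.ofReal (objective K α) ≤ d := by
  obtain ⟨L, P, hL, hE, hD⟩ := h
  set E : ℕ → ℝ := fun j => ∑ θ, ((P j).equivocation θ).toReal with hEdef
  have hE' : ∀ j k, ((P j).equivocation k).toReal ≤ E j := fun j k =>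
    Finset.single_le_sum (f := fun θ => ((P j).equivocation θ).toReal)
      (fun _ _ => ENNReal.toReal_nonneg) (Finset.mem_univ k)
  have hElim : Tendsto (fun j => E j / L j) atTop (𝓝 0) := by
    have h1 : ∀ θ, Tendsto (fun j => ((P j).equivocation θ).toReal / L j) atTop (𝓝 0) := by
      intro θ
      have := (ENNReal.tendsto_toReal ENNReal.zero_ne_top).comp (hE θ)
      simpa [Function.comp_def, ENNReal.toReal_div] using this
    simpa [hEdef, Finset.sum_div] using tendsto_finsetSum Finset.univ fun θ _ => h1 θ
  have hLpos : ∀ᶠ j in atTop, 0 < L j := hL.eventually_gt_atTop 0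
  obtain ⟨j₀, hj₀⟩ := eventually_atTop.1 hLpos
  obtain ⟨α, -, φ, hφ, hlim⟩ := isCompact_Icc.tendsto_subseq
    (x := fun j => (P (j + j₀)).share) (s := Set.Icc 0 1) fun j =>
      ⟨fun S => (P _).share_nonneg S, fun S => (P _).share_le_one hK (hj₀ _ (by omega)) S⟩
  set ψ : ℕ → ℕ := fun j => φ j + j₀ with hψ
  have hψt : Tendsto ψ atTop atTop := (tendsto_add_atTop_nat j₀).comp hφ.tendsto_atTop
  have hLψ : ∀ j, 0 < L (ψ j) := fun j => hj₀ _ (by simp [hψ])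
  have hlim' : Tendsto (fun j => (P (ψ j)).share) atTop (𝓝 α) := hlim
  have hcoord : ∀ S, Tendsto (fun j => (P (ψ j)).share S) atTop (𝓝 (α S)) := fun S =>
    (tendsto_pi_nhds.1 hlim') S
  have hα0 : ∀ S, 0 ≤ α S := fun S =>
    ge_of_tendsto' (hcoord S) fun j => (P _).share_nonneg S
  have hEψ := hElim.comp hψt
  have hempty : α ∅ = 0 := by
    refine le_antisymm (le_of_tendsto_of_tendsto' (hcoord ∅) hEψ fun j => ?_) (hα0 ∅)
    exact (P _).share_empty_le (hE' _) hK (hLψ j)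
  have hfeas : α ∈ feasible m := by
    refine ⟨hα0, ?_, fun n => ?_⟩
    · have h1 : ∑ S, α S = 1 := tendsto_nhds_unique (tendsto_finsetSum _ fun S _ => hcoord S)
        (by simp only [(P _).sum_share hK (hLψ _)]; exact tendsto_const_nhds)
      rw [← h1]
      refine Finset.sum_subset (Finset.filter_subset _ _) fun S _ hS => ?_
      have : S = ∅ := by simpa using hS
      rw [this, hempty]
    · exact le_of_tendsto' (tendsto_finsetSum _ fun S _ => hcoord S) fun j =>
        (P _).sum_share_of_mem_le hK (hLψ j) n (hm n)
  refine ⟨α, hfeas, ?_⟩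
  rw [ENNReal.ofReal_le_iff_le_toReal hd]
  refine le_of_forall_gt_imp_ge_of_dense fun d' hd' => ?_
  have hd'0 : 0 < d' := ENNReal.toReal_nonneg.trans_lt hd'
  have hlt : d < ENNReal.ofReal d' := (ENNReal.lt_ofReal_iff_toReal_lt hd).2 hd'
  have hev : ∀ᶠ j in atTop, ∀ θ, (P j).downloadCost θ / (L j : ℝ≥0∞) < ENNReal.ofReal d' :=
    eventually_all.2 fun θ => eventually_lt_of_limsup_lt ((hD θ).trans_lt hlt)
  have hbound : ∀ᶠ j in atTop, objective K (P (ψ j)).share ≤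
      d' + (1 + K * N) * (E (ψ j) / L (ψ j)) := by
    filter_upwards [hψt.eventually hev] with j hj
    have hLr : (0 : ℝ) < L (ψ j) := by exact_mod_cast hLψ j
    have := (P (ψ j)).objective_share_le (hE' _) (c := d' * L (ψ j)) (by positivity)
      (fun θ => by
        have h1 := (hj θ).le
        rw [ENNReal.div_le_iff (by exact_mod_cast (hLψ j).ne') (ENNReal.natCast_ne_top _)] at h1
        rwa [ENNReal.ofReal_mul hd'0.le, ENNReal.ofReal_natCast]) hK (hLψ j)
    refine le_of_mul_le_mul_left (this.trans (le_of_eq ?_)) hLr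
    field_simp
  have hobj : Tendsto (fun j => objective K (P (ψ j)).share) atTop (𝓝 (objective K α)) :=
    ((continuous_objective K).tendsto α).comp hlim'
  have hrhs : Tendsto (fun j => d' + (1 + K * N) * (E (ψ j) / L (ψ j))) atTop (𝓝 d') := by
    simpa using (hEψ.const_mul (1 + (K : ℝ) * N)).const_add d'
  exact le_of_tendsto_of_tendsto hobj hrhs hbound

/-! ### The retrieval protocol -/

section Protocol

variable {N K : ℕ} {b c : Finset (Fin N) → ℕ}

/-- The bits of a file that are placed somewhere: for every set `S` of databases, `|S| - 1` symbols
of `b S` bits each, which are retrieved privately, and `c S` bits which are downloaded for all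
files. The latter are meant for the singletons, on which the former scheme is void. -/
abbrev Slot (b c : Finset (Fin N) → ℕ) : Type :=
  Σ S : Finset (Fin N), (Fin (S.card - 1) × Fin (b S)) ⊕ Fin (c S)

/-- The coordinates of an answer: for every `S`, one symbol of `b S` bits and the `c S` raw bits of
each of the `K` files. -/
abbrev AnswerIndex (K : ℕ) (b c : Finset (Fin N) → ℕ) : Type :=
  (Σ S : Finset (Fin N), Fin (b S)) ⊕ (Fin K × Σ S : Finset (Fin N), Fin (c S))

/-- The finite group from which keys and queries are taken: for every `S`, one residue modulo `|S|`
for each file. (The modulus is written `|S| - 1 + 1`, so that it is `1` for `S = ∅`.) -/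
abbrev Key (N K : ℕ) : Type :=
  (S : Finset (Fin N)) → Fin K → Fin (S.card - 1 + 1)

/-- A numbering of the databases in `S` by the residues modulo `|S|`. -/
def databaseIndex (S : Finset (Fin N)) (n : Fin N) : Fin (S.card - 1 + 1) :=
  if h : n ∈ S then
    Fin.cast (Nat.sub_add_cancel (Finset.card_pos.2 ⟨n, h⟩)).symm (S.equivFin ⟨n, h⟩)
  else 0

lemma exists_databaseIndex_eq {S : Finset (Fin N)} (hS : S.Nonempty) (y : Fin (S.card - 1 + 1)) :
    ∃ n ∈ S, databaseIndex S n = y := by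
  have h : S.card - 1 + 1 = S.card := Nat.sub_add_cancel hS.card_pos
  refine ⟨S.equivFin.symm (Fin.cast h y), (S.equivFin.symm (Fin.cast h y)).2, ?_⟩
  simp [databaseIndex]

/-- The difference between the query to database `n` and the key when file `θ` is desired: its
residues are those of database `n` at file `θ`, and `0` at the other files. -/
def keyShift (θ : Fin K) (n : Fin N) : Key N K :=
  fun S => Pi.single θ (databaseIndex S n)

/-- A bit as an element of the field with two elements. -/
def bitToZMod (x : Bool) : ZMod 2 := if x then 1 else 0

lemma bitToZMod_injective : Function.Injective bitToZMod := by
  intro x y; revert x y; decide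

/-- Bit `i` of the symbol with number `y` in the part `S` of a file; the symbol with number `0` is a
dummy that vanishes. -/
def symbolBit (u : Slot b c → Bool) (S : Finset (Fin N)) (i : Fin (b S)) :
    Fin (S.card - 1 + 1) → ZMod 2 :=
  Fin.cases 0 fun x => bitToZMod (u ⟨S, Sum.inl (x, i)⟩)

/-- The answer of database `n` to the query `q`: for every `S ∋ n`, the sum over all files of the
symbols that the query selects, and all the raw bits. -/
def protocolAnswer (n : Fin N) (q : Key N K) (u : Fin K → Slot b c → Bool) :
    AnswerIndex K b c → ZMod 2 :=
  Sum.elim (fun r => if n ∈ r.1 then ∑ k, symbolBit (u k) r.1 r.2 (q r.1 k) else 0)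
    fun r => if n ∈ r.2.1 then bitToZMod (u r.1 ⟨r.2.1, Sum.inr r.2.2⟩) else 0

/-- The answer of database `n` depends only on what is stored there. -/
lemma protocolAnswer_congr (n : Fin N) (q : Key N K) {u u' : Fin K → Slot b c → Bool}
    (h : ∀ k r, n ∈ r.1 → u k r = u' k r) : protocolAnswer n q u = protocolAnswer n q u' := by
  funext r
  rcases r with ⟨S, i⟩ | ⟨k, S, i⟩
  · simp only [protocolAnswer, Sum.elim_inl]
    split_ifs with hn
    · refine Finset.sum_congr rfl fun k _ => ?_
      have hu : symbolBit (u k) S i = symbolBit (u' k) S i := by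
        funext y
        refine Fin.cases rfl (fun x => ?_) y
        exact congrArg bitToZMod (h k ⟨S, Sum.inl (x, i)⟩ hn)
      rw [hu]
    · rfl
  · simp only [protocolAnswer, Sum.elim_inr]
    split_ifs with hn
    · rw [h k ⟨S, Sum.inr i⟩ hn]
    · rfl

/-- The coordinates of an answer that do not vanish identically: no symbol is downloaded for `S` when
the query is zero there. -/
def IsActive (n : Fin N) (q : Key N K) : AnswerIndex K b c → Prop :=
  Sum.elim (fun r => n ∈ r.1 ∧ q r.1 ≠ 0) fun r => n ∈ r.2.1

lemma isActive_inl {n : Fin N} {q : Key N K} {S : Finset (Fin N)} {i : Fin (b S)} :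
    IsActive n q (Sum.inl ⟨S, i⟩ : AnswerIndex K b c) ↔ n ∈ S ∧ q S ≠ 0 := Iff.rfl

lemma isActive_inr {n : Fin N} {q : Key N K} {k : Fin K} {S : Finset (Fin N)} {i : Fin (c S)} :
    IsActive n q (Sum.inr ⟨k, S, i⟩ : AnswerIndex K b c) ↔ n ∈ S := Iff.rfl

lemma protocolAnswer_eq_zero (n : Fin N) (q : Key N K) (u : Fin K → Slot b c → Bool)
    (r : AnswerIndex K b c) (hr : ¬ IsActive n q r) : protocolAnswer n q u r = 0 := by
  rcases r with ⟨S, i⟩ | ⟨k, S, i⟩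
  · rw [isActive_inl, not_and, not_not] at hr
    simp only [protocolAnswer, Sum.elim_inl]
    split_ifs with hn
    · refine Finset.sum_eq_zero fun k _ => ?_
      rw [hr hn]
      rfl
    · rfl
  · rw [isActive_inr] at hr
    simp only [protocolAnswer, Sum.elim_inr, if_neg hr]

open Classical in
lemma card_isActive (n : Fin N) (q : Key N K) :
    ((Finset.univ.filter fun r : AnswerIndex K b c => IsActive n q r).card : ℝ) =
      ∑ S with n ∈ S, ((if q S ≠ 0 then (b S : ℝ) else 0) + K * c S) := by
  rw [Finset.card_filter, Fintype.sum_sum_type, Fintype.sum_sigma, Fintype.sum_prod_type]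
  simp only [Fintype.sum_sigma, isActive_inl, isActive_inr, Finset.sum_const, Finset.card_univ,
    Fintype.card_fin, smul_eq_mul]
  push_cast
  rw [Finset.mul_sum, ← Finset.sum_add_distrib, Finset.sum_filter]
  refine Finset.sum_congr rfl fun S _ => ?_
  by_cases h1 : n ∈ S <;> by_cases h2 : q S = 0 <;> simp [h1, h2]

lemma unifEntropy_le_card_of_eq_zero {Ω ι : Type*} [Fintype Ω] [Nonempty Ω]
    (f : Ω → ι → ZMod 2) (B : Finset ι) (hf : ∀ w, ∀ r ∉ B, f w r = 0) :
    unifEntropy f ≤ B.card := by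
  classical
  refine (unifEntropy_mono (g := fun w (r : B) => f w r) fun w w' h => ?_).trans
    ((unifEntropy_le_logb_card _).trans (le_of_eq ?_))
  · funext r
    by_cases hr : r ∈ B
    · exact congrFun h ⟨r, hr⟩
    · rw [hf w r hr, hf w' r hr]
  · simp [ZMod.card, Real.logb_pow]

/-- Decoding: two choices of the files for which all databases give the same answers have the same
desired file. For a symbol `x` of the part `S`, the databases whose query selects `x` and the dummy
in file `θ` receive the same query for the other files, so their answers differ by `x`. -/
lemma protocolAnswer_decode (θ : Fin K) (v : Key N K) {u u' : Fin K → Slot b c → Bool}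
    (hc : ∀ S, c S ≠ 0 → S.Nonempty)
    (h : ∀ n, protocolAnswer n (v + keyShift θ n) u = protocolAnswer n (v + keyShift θ n) u') :
    u θ = u' θ := by
  have key : ∀ (S : Finset (Fin N)) (i : Fin (b S)) (y : Fin (S.card - 1 + 1)) (n n₀ : Fin N),
      n ∈ S → n₀ ∈ S → v S θ + databaseIndex S n = y → v S θ + databaseIndex S n₀ = 0 →
      ∀ u : Fin K → Slot b c → Bool, symbolBit (u θ) S i y =
        protocolAnswer n (v + keyShift θ n) u (Sum.inl ⟨S, i⟩) -
          protocolAnswer n₀ (v + keyShift θ n₀) u (Sum.inl ⟨S, i⟩) := by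
    intro S i y n n₀ hn hn₀ hy h0 u
    simp only [protocolAnswer, Sum.elim_inl, if_pos hn, if_pos hn₀]
    rw [← Finset.sum_sub_distrib, Finset.sum_eq_single θ]
    · simp only [Pi.add_apply, keyShift, Pi.single_eq_same, hy, h0]
      simp [symbolBit]
    · intro k _ hk
      simp [Pi.add_apply, keyShift, Pi.single_eq_of_ne hk]
    · simp
  funext ⟨S, r⟩
  rcases r with ⟨x, i⟩ | i
  · have hS : S.Nonempty := Finset.card_pos.1 (by have := x.pos; omega)
    obtain ⟨n, hn, hy⟩ := exists_databaseIndex_eq hS (x.succ - v S θ)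
    obtain ⟨n₀, hn₀, h0⟩ := exists_databaseIndex_eq hS (-v S θ)
    have hk := key S i x.succ n n₀ hn hn₀ (by rw [hy]; abel) (by rw [h0]; abel)
    refine bitToZMod_injective ?_
    change symbolBit (u θ) S i x.succ = symbolBit (u' θ) S i x.succ
    rw [hk u, hk u', h n, h n₀]
  · obtain ⟨n, hn⟩ := hc S (by have := i.pos; omega)
    have := congrFun (h n) (Sum.inr (θ, ⟨S, i⟩))
    simp only [protocolAnswer, Sum.elim_inr, if_pos hn] at this
    exact bitToZMod_injective this

end Protocol

/-! ### The protocol as a scheme -/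

section ProtocolScheme

variable {N K L : ℕ} {b c : Finset (Fin N) → ℕ}

lemma uniformOn_univ_singleton {α : Type*} [Fintype α] [MeasurableSpace α]
    [MeasurableSingletonClass α] (x : α) :
    uniformOn (Set.univ : Set α) {x} = (Fintype.card α : ℝ≥0∞)⁻¹ := by
  rw [uniformOn_univ, Measure.count_singleton, one_div]

/-- The joint law of independent uniform files and keys. -/
def protocolMeasure (N K L : ℕ) : Measure ((Fin K → Fin L → Bool) × Key N K) :=
  (uniformOn Set.univ).prod (uniformOn Set.univ)

instance : IsProbabilityMeasure (protocolMeasure N K L) := by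
  unfold protocolMeasure; infer_instance

lemma protocolMeasure_singleton (x : (Fin K → Fin L → Bool) × Key N K) :
    protocolMeasure N K L {x} = (Fintype.card (Fin K → Fin L → Bool) : ℝ≥0∞)⁻¹ *
      (Fintype.card (Key N K) : ℝ≥0∞)⁻¹ := by
  obtain ⟨w, v⟩ := x
  rw [protocolMeasure, ← Set.singleton_prod_singleton, Measure.prod_prod,
    uniformOn_univ_singleton, uniformOn_univ_singleton]

/-- Keys are uniform on a group, so a translation of the key preserves the law. -/
lemma map_translate_protocolMeasure (s : Key N K) :
    (protocolMeasure N K L).map (fun x => (x.1, x.2 + s)) = protocolMeasure N K L := by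
  refine Measure.ext_of_singleton fun x => ?_
  have h : (fun x : (Fin K → Fin L → Bool) × Key N K => (x.1, x.2 + s)) ⁻¹' {x} =
      {(x.1, x.2 - s)} := by
    ext y
    simp only [Set.mem_preimage, Set.mem_singleton_iff, Prod.ext_iff, eq_sub_iff_add_eq]
  rw [Measure.map_apply .of_discrete (measurableSet_singleton x), h, protocolMeasure_singleton,
    protocolMeasure_singleton]

lemma protocolMeasure_fst (w : Fin K → Fin L → Bool) :
    protocolMeasure N K L (Prod.fst ⁻¹' {w}) = ((2 : ℝ≥0∞) ^ (K * L))⁻¹ := by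
  have h : (Prod.fst ⁻¹' {w} : Set ((Fin K → Fin L → Bool) × Key N K)) = {w} ×ˢ Set.univ := by
    ext; simp
  rw [h, protocolMeasure, Measure.prod_prod, uniformOn_univ_singleton, measure_univ, mul_one]
  simp [← pow_mul, mul_comm]

/-- The bits of the slots over `S` are placed in `S`, and the bits outside the range of `e` nowhere.
All files are placed alike. -/
def slotPlacement (e : Slot b c ↪ Fin L) (p : Fin K × Fin L) : Finset (Fin N) :=
  Function.extend e Sigma.fst (fun _ => ∅) p.2

lemma slotPlacement_apply (e : Slot b c ↪ Fin L) (k : Fin K) (r : Slot b c) :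
    slotPlacement e (k, e r) = r.1 :=
  e.injective.extend_apply _ _ _

lemma card_mem_slotPlacement_le (e : Slot b c ↪ Fin L) (n : Fin N) :
    (Finset.univ.filter fun p : Fin K × Fin L => n ∈ slotPlacement e p).card ≤
      K * ∑ S with n ∈ S, ((S.card - 1) * b S + c S) := by
  classical
  have h : (Finset.univ.filter fun p : Fin K × Fin L => n ∈ slotPlacement e p) ⊆
      (Finset.univ ×ˢ ((Finset.univ : Finset (Slot b c)).filter fun r => n ∈ r.1)).image
        fun x : Fin K × Slot b c => (x.1, e x.2) := by
    rintro ⟨k, i⟩ hp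
    simp only [Finset.mem_filter, Finset.mem_univ, true_and, Finset.mem_image, Finset.mem_product,
      Prod.mk.injEq, Prod.exists] at hp ⊢
    by_cases hi : ∃ r, e r = i
    · obtain ⟨r, rfl⟩ := hi
      rw [slotPlacement_apply] at hp
      exact ⟨k, r, hp, rfl, rfl⟩
    · rw [slotPlacement, Function.extend_apply' _ _ _ hi] at hp
      simp at hp
  refine (Finset.card_le_card h).trans (Finset.card_image_le.trans (le_of_eq ?_))
  rw [Finset.card_product, Finset.card_univ, Fintype.card_fin, Finset.card_filter,
    Fintype.sum_sigma, Finset.sum_filter]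
  congr 1
  refine Finset.sum_congr rfl fun S _ => ?_
  by_cases hS : n ∈ S <;> simp [hS]

/-- The files cut into slots. -/
def slotBits (e : Slot b c ↪ Fin L) (w : Fin K → Fin L → Bool) (k : Fin K) (r : Slot b c) : Bool :=
  w k (e r)

/-- The answering function of the protocol, which sees only the content `z` of database `n`. -/
def contentAnswer (e : Slot b c ↪ Fin L) (n : Fin N) (q : Key N K)
    (z : {p : Fin K × Fin L // n ∈ slotPlacement e p} → Bool) : AnswerIndex K b c → ZMod 2 :=
  protocolAnswer n q fun k r =>
    if h : n ∈ slotPlacement e (k, e r) then z ⟨(k, e r), h⟩ else false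

lemma contentAnswer_eq (e : Slot b c ↪ Fin L) (n : Fin N) (q : Key N K)
    (w : Fin K → Fin L → Bool) :
    contentAnswer e n q (fun p => w p.1.1 p.1.2) = protocolAnswer n q (slotBits e w) :=
  protocolAnswer_congr n q fun k r hr => by
    rw [← slotPlacement_apply e k r] at hr
    simp [hr, slotBits]

/-- The scheme in which database `n` receives the uniform key translated by `keyShift θ n`. -/
def protocolScheme (m : Fin N → ℝ) (e : Slot b c ↪ Fin L)
    (hs : ∀ n, ((∑ S with n ∈ S, ((S.card - 1) * b S + c S) : ℕ) : ℝ) ≤ m n * L) :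
    Scheme m K L where
  Ω := (Fin K → Fin L → Bool) × Key N K
  μ := protocolMeasure N K L
  Query := Key N K
  Answer := AnswerIndex K b c → ZMod 2
  W := Prod.fst
  measurable_W := measurable_fst
  uniform_W := protocolMeasure_fst
  placement := slotPlacement e
  Q θ n x := x.2 + keyShift θ n
  measurable_Q _ _ := .of_discrete
  indep_Q θ := indepFun_prod (X := id) (Y := fun v n => v + keyShift θ n) measurable_id
    .of_discrete
  answer := contentAnswer e
  storage n := by
    classical
    rw [entropy_content measurable_fst protocolMeasure_fst
      (Finset.univ.filter fun p => n ∈ slotPlacement e p) _ (by simp), ← ENNReal.ofReal_natCast]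
    refine ENNReal.ofReal_le_ofReal ?_
    calc _ ≤ ((K * ∑ S with n ∈ S, ((S.card - 1) * b S + c S) : ℕ) : ℝ) := by
          exact_mod_cast card_mem_slotPlacement_le e n
      _ ≤ K * (m n * L) := by
          rw [Nat.cast_mul]
          exact mul_le_mul_of_nonneg_left (hs n) (by positivity)
      _ = m n * (K * L) := by ring
  privacy n θ θ' := by
    refine ⟨Measurable.of_discrete.aemeasurable, Measurable.of_discrete.aemeasurable, ?_⟩
    conv_rhs => rw [← map_translate_protocolMeasure (keyShift θ n - keyShift θ' n),
      Measure.map_map .of_discrete .of_discrete]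
    congr 1
    funext x
    simp [add_assoc]

variable {m : Fin N → ℝ} {e : Slot b c ↪ Fin L}
  {hs : ∀ n, ((∑ S with n ∈ S, ((S.card - 1) * b S + c S) : ℕ) : ℝ) ≤ m n * L}

instance : Fintype (protocolScheme (K := K) m e hs).Query :=
  inferInstanceAs (Fintype (Key N K))

lemma resp_protocolScheme (n : Fin N) (q : Key N K) (w : Fin K → Fin L → Bool) :
    (protocolScheme m e hs).resp n q w = protocolAnswer n q (slotBits e w) :=
  contentAnswer_eq e n q w

/-- Only the bits outside the slots may remain unknown. -/
lemma equivocation_protocolScheme_le (hc : ∀ S, c S ≠ 0 → S.Nonempty) (θ : Fin K) :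
    (protocolScheme m e hs).equivocation θ ≤
      ((L - ∑ S, ((S.card - 1) * b S + c S) : ℕ) : ℝ≥0∞) := by
  classical
  set P := protocolScheme m e hs
  set B : Finset (Fin K × Fin L) := {θ} ×ˢ (Finset.univ.map e)ᶜ with hB
  have hBcard : B.card = L - ∑ S, ((S.card - 1) * b S + c S) := by
    rw [hB, Finset.card_product, Finset.card_singleton, one_mul, Finset.card_compl,
      Finset.card_map, Finset.card_univ, Fintype.card_fin]
    congr 1
    simp [Fintype.card_sigma]
  rw [P.equivocation_eq, ← hBcard, ← ENNReal.ofReal_natCast, ← unifEntropy_bitsAt]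
  calc _ ≤ ∫⁻ _, ENNReal.ofReal (unifEntropy (bitsAt B)) ∂P.μ := by
        refine lintegral_mono fun x => ENNReal.ofReal_le_ofReal ?_
        refine (unifCondEntropy_mono (g := bitsAt B) fun w w' hw hA => ?_).trans
          (unifCondEntropy_le_unifEntropy _ _)
        have hslot : slotBits e w θ = slotBits e w' θ := by
          refine protocolAnswer_decode θ x.2 hc fun n => ?_
          have := congrFun hA n
          exact (resp_protocolScheme n _ w).symm.trans (this.trans (resp_protocolScheme n _ w'))
        rw [bitsAt_eq_iff] at hw
        funext i
        by_cases hi : ∃ r, e r = i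
        · obtain ⟨r, rfl⟩ := hi
          exact congrFun hslot r
        · exact hw (θ, i) (by simpa [hB] using hi)
    _ = _ := by rw [lintegral_const, measure_univ, mul_one]

/-- The query to a database is uniform, so it vanishes on the part `S` with probability
`|S|⁻ᴷ`. -/
lemma measure_query_eq_zero (θ : Fin K) (n : Fin N) (S : Finset (Fin N)) :
    (protocolMeasure N K L).real {x | (x.2 + keyShift θ n) S = 0} =
      1 / ((S.card - 1 + 1 : ℕ) : ℝ) ^ K := by
  classical
  set f : (Fin K → Fin L → Bool) × Key N K → Fin K → Fin (S.card - 1 + 1) :=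
    fun x => (x.2 + keyShift θ n) S with hf
  have trans : ∀ y, (protocolMeasure N K L).real (f ⁻¹' {y}) =
      (protocolMeasure N K L).real (f ⁻¹' {0}) := by
    intro y
    conv_lhs => rw [← map_translate_protocolMeasure (L := L) (Pi.single S y)]
    rw [map_measureReal_apply .of_discrete (Set.toFinite _).measurableSet]
    congr 1
    ext x
    simp only [hf, Set.mem_preimage, Set.mem_singleton_iff, Pi.add_apply, Pi.single_eq_same]
    rw [add_right_comm, add_eq_right]
  have hsum := sum_measureReal_preimage_singleton (μ := protocolMeasure N K L) (f := f)
    Finset.univ fun y _ => (Set.toFinite _).measurableSet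
  rw [Finset.sum_congr rfl fun y _ => trans y, Finset.sum_const, Finset.card_univ] at hsum
  simp only [Fintype.card_fun, Fintype.card_fin, nsmul_eq_mul, Finset.coe_univ, Set.preimage_univ,
    probReal_univ, Nat.cast_pow] at hsum
  have : (protocolMeasure N K L).real {x | (x.2 + keyShift θ n) S = 0} =
      (protocolMeasure N K L).real (f ⁻¹' {0}) := rfl
  rw [this, eq_div_iff (by positivity), mul_comm]
  exact hsum

lemma lintegral_unifEntropy_protocolAnswer_le (θ : Fin K) (n : Fin N) :
    ∫⁻ x, ENNReal.ofReal (unifEntropy fun w => protocolAnswer n (x.2 + keyShift θ n)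
      (slotBits e w)) ∂protocolMeasure N K L ≤
    ENNReal.ofReal (∑ S with n ∈ S,
      (b S * (1 - 1 / ((S.card - 1 + 1 : ℕ) : ℝ) ^ K) + K * c S)) := by
  classical
  set μ := protocolMeasure N K L
  have h1 : ∀ S, ∫ x, (if (x.2 + keyShift θ n) S ≠ 0 then (b S : ℝ) else 0) ∂μ =
      b S * (1 - 1 / ((S.card - 1 + 1 : ℕ) : ℝ) ^ K) := by
    intro S
    have hset : {x : (Fin K → Fin L → Bool) × Key N K | (x.2 + keyShift θ n) S ≠ 0} =
        {x | (x.2 + keyShift θ n) S = 0}ᶜ := rfl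
    have hind : (fun x : (Fin K → Fin L → Bool) × Key N K =>
        if (x.2 + keyShift θ n) S ≠ 0 then (b S : ℝ) else 0) =
        Set.indicator {x | (x.2 + keyShift θ n) S ≠ 0} fun _ => (b S : ℝ) := by
      funext x
      simp [Set.indicator_apply]
    rw [hind, integral_indicator_const _ (Set.toFinite _).measurableSet, hset,
      probReal_compl_eq_one_sub (Set.toFinite _).measurableSet, measure_query_eq_zero,
      smul_eq_mul, mul_comm]
  have h2 : ∫ x, ∑ S with n ∈ S, ((if (x.2 + keyShift θ n) S ≠ 0 then (b S : ℝ) else 0) +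
      K * c S) ∂μ = ∑ S with n ∈ S,
      (b S * (1 - 1 / ((S.card - 1 + 1 : ℕ) : ℝ) ^ K) + K * c S) := by
    rw [integral_finsetSum _ fun _ _ => .of_finite]
    refine Finset.sum_congr rfl fun S _ => ?_
    rw [integral_add .of_finite .of_finite, h1, integral_const, probReal_univ, one_smul]
  rw [← h2, ofReal_integral_eq_lintegral_ofReal .of_finite (ae_of_all _ fun x =>
    Finset.sum_nonneg fun S _ => by positivity)]
  refine lintegral_mono fun x => ENNReal.ofReal_le_ofReal ?_
  rw [← card_isActive (b := b) (c := c) n (x.2 + keyShift θ n)]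
  exact unifEntropy_le_card_of_eq_zero _ _ fun w r hr =>
    protocolAnswer_eq_zero n _ _ r (by simpa using hr)

/-- Up to a constant that pays for the entropy of the queries, the download consists of the symbols
selected by nonzero queries and of the raw bits. -/
lemma downloadCost_protocolScheme_le (θ : Fin K) :
    (protocolScheme m e hs).downloadCost θ ≤
      ENNReal.ofReal (N * (Fintype.card (Key N K) / Real.log 2) + ∑ S : Finset (Fin N),
        S.card * (b S * (1 - 1 / ((S.card - 1 + 1 : ℕ) : ℝ) ^ K) + K * c S)) := by
  classical
  have hlog : 0 ≤ Real.log 2 := Real.log_nonneg (by norm_num)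
  have hnn : ∀ S : Finset (Fin N),
      0 ≤ (b S * (1 - 1 / ((S.card - 1 + 1 : ℕ) : ℝ) ^ K) + K * c S : ℝ) := fun S => by
    have : 1 / ((S.card - 1 + 1 : ℕ) : ℝ) ^ K ≤ 1 := by
      rw [div_le_one (by positivity)]
      exact one_le_pow₀ (by push_cast; linarith [Nat.cast_nonneg (α := ℝ) (S.card - 1)])
    have := sub_nonneg.2 this
    positivity
  have h1 : ∀ n, entropy (protocolScheme (K := K) m e hs).μ
      ((protocolScheme (K := K) m e hs).A θ n) ≤
      ENNReal.ofReal (Fintype.card (Key N K) / Real.log 2 + ∑ S with n ∈ S,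
        (b S * (1 - 1 / ((S.card - 1 + 1 : ℕ) : ℝ) ^ K) + K * c S)) := by
    intro n
    refine ((protocolScheme (K := K) m e hs).entropy_A_le θ n).trans ?_
    rw [ENNReal.ofReal_add (by positivity) (Finset.sum_nonneg fun S _ => hnn S)]
    refine add_le_add le_rfl (le_trans (le_of_eq ?_)
      (lintegral_unifEntropy_protocolAnswer_le (e := e) θ n))
    refine lintegral_congr fun x => ?_
    congr 2
    funext w
    exact resp_protocolScheme n _ w
  refine (Finset.sum_le_sum fun n _ => h1 n).trans (le_of_eq ?_)
  rw [← ENNReal.ofReal_sum_of_nonneg fun n _ => add_nonneg (by positivity)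
    (Finset.sum_nonneg fun S _ => hnn S), Finset.sum_add_distrib]
  congr 2
  · simp
  · simp_rw [Finset.sum_filter]
    rw [Finset.sum_comm]
    refine Finset.sum_congr rfl fun S _ => ?_
    rw [← Finset.sum_filter, Finset.sum_const, nsmul_eq_mul]
    congr 2
    simp

end ProtocolScheme

/-! ### Achievability -/

section Achievability

variable {N K : ℕ} (α : Finset (Fin N) → ℝ) (L : ℕ)

/-- The symbol length for the part `S` of files of `L` bits. For `|S| ≤ 1` it is `0` by the
convention `x / 0 = 0`. -/
def symbolLength (S : Finset (Fin N)) : ℕ := ⌊α S * L / (S.card - 1 : ℕ)⌋₊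

/-- The number of bits of each file that are placed in the singleton `S`. -/
def rawLength (S : Finset (Fin N)) : ℕ := if S.card = 1 then ⌊α S * L⌋₊ else 0

/-- The number of bits of each file that are placed in `S`. -/
def slotCount (S : Finset (Fin N)) : ℕ := (S.card - 1) * symbolLength α L S + rawLength α L S

variable {α L}

lemma slotCount_eq_zero {S : Finset (Fin N)} (hS : S.card = 0) : slotCount α L S = 0 := by
  simp [slotCount, rawLength, hS]

lemma slotCount_le (hα : ∀ S, 0 ≤ α S) (S : Finset (Fin N)) : (slotCount α L S : ℝ) ≤ α S * L := by
  have h0 : 0 ≤ α S * L := mul_nonneg (hα S) (by positivity)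
  by_cases h1 : S.card = 1
  · simpa [slotCount, rawLength, h1] using Nat.floor_le h0
  · rw [slotCount, rawLength, if_neg h1, add_zero, Nat.cast_mul]
    rcases Nat.eq_zero_or_pos (S.card - 1) with h2 | h2
    · simpa [h2] using h0
    · have h3 : (0 : ℝ) < (S.card - 1 : ℕ) := by exact_mod_cast h2
      calc _ ≤ ((S.card - 1 : ℕ) : ℝ) * (α S * L / (S.card - 1 : ℕ)) := by
            gcongr
            exact Nat.floor_le (by positivity)
        _ = α S * L := by field_simp

lemma le_slotCount_add {S : Finset (Fin N)} (hS : 1 ≤ S.card) :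
    α S * L ≤ slotCount α L S + (N + 1) := by
  have hN : (S.card : ℝ) ≤ N := by
    have := Finset.card_le_univ S
    rw [Fintype.card_fin] at this
    exact_mod_cast this
  by_cases h1 : S.card = 1
  · have := Nat.lt_floor_add_one (α S * L)
    simp only [slotCount, rawLength, h1, Nat.sub_self, zero_mul, zero_add, if_true]
    linarith [Nat.cast_nonneg (α := ℝ) N]
  · have h2 : 0 < S.card - 1 := by omega
    have h3 : (0 : ℝ) < (S.card - 1 : ℕ) := by exact_mod_cast h2
    have h4 : ((S.card - 1 : ℕ) : ℝ) ≤ N := by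
      rw [Nat.cast_sub hS]; push_cast; linarith
    have h5 := (div_lt_iff₀ h3).1 (Nat.lt_floor_add_one (α S * L / (S.card - 1 : ℕ)))
    rw [slotCount, rawLength, if_neg h1, add_zero, Nat.cast_mul, symbolLength]
    linarith

/-- The download for the part `S` is the summand of the objective function. -/
lemma download_le (hα : ∀ S, 0 ≤ α S) {S : Finset (Fin N)} (hS : 1 ≤ S.card) :
    S.card * (symbolLength α L S * (1 - 1 / ((S.card - 1 + 1 : ℕ) : ℝ) ^ K) +
      K * rawLength α L S) ≤ L * (α S * ∑ i ∈ Finset.range K, 1 / (S.card : ℝ) ^ i) := by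
  have h0 : 0 ≤ α S * L := mul_nonneg (hα S) (by positivity)
  rw [Nat.sub_add_cancel hS]
  by_cases h1 : S.card = 1
  · have := Nat.floor_le h0
    simp only [rawLength, h1, if_true, Nat.cast_one, one_pow, div_one, sub_self, mul_zero, zero_add,
      one_mul, Finset.sum_const, Finset.card_range, nsmul_eq_mul, mul_one]
    have hK : (0 : ℝ) ≤ K := by positivity
    nlinarith
  · have h2 : (1 : ℝ) < S.card := by exact_mod_cast (by omega : 1 < S.card)
    have h3 : (0 : ℝ) < S.card - 1 := by linarith
    have hb : (symbolLength α L S : ℝ) ≤ α S * L / (S.card - 1) := by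
      have := Nat.floor_le (div_nonneg h0 h3.le)
      rw [symbolLength, Nat.cast_sub hS, Nat.cast_one]
      exact this
    have hp : 0 ≤ 1 - 1 / (S.card : ℝ) ^ K := by
      rw [sub_nonneg, div_le_one (by positivity)]
      exact one_le_pow₀ h2.le
    have hgeom : ∑ i ∈ Finset.range K, 1 / (S.card : ℝ) ^ i =
        S.card * (1 - 1 / (S.card : ℝ) ^ K) / (S.card - 1) := by
      have h := geom_sum_mul_neg (1 / (S.card : ℝ)) K
      simp only [one_div, inv_pow] at h ⊢
      rw [eq_div_iff h3.ne', ← h]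
      field_simp
    rw [rawLength, if_neg h1, hgeom]
    calc _ = S.card * (symbolLength α L S * (1 - 1 / (S.card : ℝ) ^ K)) := by simp
      _ ≤ S.card * (α S * L / (S.card - 1) * (1 - 1 / (S.card : ℝ) ^ K)) := by gcongr
      _ = _ := by ring

lemma sum_eq_sum_filter_card {f : Finset (Fin N) → ℝ} (hf : ∀ S, S.card = 0 → f S = 0) :
    ∑ S, f S = ∑ S with 1 ≤ S.card, f S := by
  refine (Finset.sum_subset (Finset.filter_subset _ _) fun S _ hS => hf S ?_).symm
  simp only [Finset.mem_filter, Finset.mem_univ, true_and] at hS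
  omega

/-- Every feasible point of the linear program is realized by schemes of the corresponding cost. -/
theorem isAchievable_of_feasible {m : Fin N → ℝ} (hα : α ∈ feasible m) :
    IsAchievable m K (ENNReal.ofReal (objective K α)) := by
  classical
  obtain ⟨h0, hsum, hmem⟩ := hα
  have hs : ∀ L n, ((∑ S with n ∈ S, ((S.card - 1) * symbolLength α L S +
      rawLength α L S) : ℕ) : ℝ) ≤ m n * L := by
    intro L n
    rw [Nat.cast_sum]
    calc _ ≤ ∑ S with n ∈ S, α S * L := Finset.sum_le_sum fun S _ => slotCount_le h0 S
      _ ≤ m n * L := by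
        rw [← Finset.sum_mul]
        exact mul_le_mul_of_nonneg_right (hmem n) (by positivity)
  have htotal : ∀ L, ∑ S, slotCount α L S ≤ L := by
    intro L
    have h : ((∑ S, slotCount α L S : ℕ) : ℝ) ≤ L := by
      rw [Nat.cast_sum, sum_eq_sum_filter_card fun S hS => by rw [slotCount_eq_zero hS]; simp]
      calc _ ≤ ∑ S : Finset (Fin N) with 1 ≤ S.card, α S * L :=
            Finset.sum_le_sum fun S _ => slotCount_le h0 S
        _ = L := by rw [← Finset.sum_mul, hsum, one_mul]
    exact_mod_cast h
  set C : ℕ := Fintype.card (Finset (Fin N)) * (N + 1) with hC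
  have hleft : ∀ L, L - ∑ S, slotCount α L S ≤ C := by
    intro L
    rw [tsub_le_iff_left]
    have h : (L : ℝ) ≤ ((∑ S, slotCount α L S + C : ℕ) : ℝ) := by
      calc (L : ℝ) = ∑ S : Finset (Fin N) with 1 ≤ S.card, α S * L := by
            rw [← Finset.sum_mul, hsum, one_mul]
        _ ≤ ∑ S : Finset (Fin N) with 1 ≤ S.card, ((slotCount α L S : ℝ) + (N + 1)) :=
            Finset.sum_le_sum fun S hS => le_slotCount_add (Finset.mem_filter.1 hS).2
        _ ≤ ∑ S : Finset (Fin N), ((slotCount α L S : ℝ) + (N + 1)) :=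
            Finset.sum_le_sum_of_subset_of_nonneg (Finset.filter_subset _ _) fun S _ _ => by
              positivity
        _ = _ := by
            rw [Finset.sum_add_distrib, hC]
            simp
            ring
    exact_mod_cast h
  have e : ∀ L, Slot (symbolLength α L) (rawLength α L) ↪ Fin L := fun L => by
    refine (Function.Embedding.nonempty_of_card_le ?_).some
    simpa [Fintype.card_sigma, slotCount] using htotal L
  have hraw : ∀ L S, rawLength α L S ≠ 0 → S.Nonempty := fun L S h => by
    by_contra hS
    rw [Finset.not_nonempty_iff_eq_empty] at hS
    simp [rawLength, hS] at h
  -- The equivocation is at most `C`, since rounding leaves at most `C` bits of a file unplaced.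
  refine ⟨fun L => L, fun L => protocolScheme m (e L) (hs L), tendsto_id, fun θ => ?_, fun θ => ?_⟩
  · have hlim : Tendsto (fun L : ℕ => (C : ℝ≥0∞) / L) atTop (𝓝 0) := by
      simpa using ENNReal.Tendsto.const_div ENNReal.tendsto_nat_nhds_top
        (Or.inr (ENNReal.natCast_ne_top C))
    refine tendsto_of_tendsto_of_tendsto_of_le_of_le tendsto_const_nhds hlim (fun _ => zero_le)
      fun L => ?_
    refine ENNReal.div_le_div_right ((equivocation_protocolScheme_le (hraw L) θ).trans ?_) _
    exact_mod_cast hleft L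
  · set D : ℝ := N * (Fintype.card (Key N K) / Real.log 2) with hD
    have hlim : Tendsto (fun L : ℕ => ENNReal.ofReal (D / L + objective K α)) atTop
        (𝓝 (ENNReal.ofReal (objective K α))) := by
      refine ENNReal.tendsto_ofReal ?_
      simpa using (tendsto_const_div_atTop_nhds_zero_nat D).add_const (objective K α)
    refine (limsup_le_limsup ?_).trans hlim.limsup_eq.le
    filter_upwards [eventually_gt_atTop 0] with L hL
    have hLr : (0 : ℝ) < L := by exact_mod_cast hL
    rw [ENNReal.div_le_iff (by exact_mod_cast hL.ne') (ENNReal.natCast_ne_top _),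
      ← ENNReal.ofReal_natCast, ← ENNReal.ofReal_mul' hLr.le]
    refine (downloadCost_protocolScheme_le θ).trans (ENNReal.ofReal_le_ofReal ?_)
    have h1 : ∑ S : Finset (Fin N), S.card * (symbolLength α L S *
        (1 - 1 / ((S.card - 1 + 1 : ℕ) : ℝ) ^ K) + K * rawLength α L S) ≤ L * objective K α := by
      rw [sum_eq_sum_filter_card fun S hS => by rw [hS]; simp, objective_eq, Finset.mul_sum]
      exact Finset.sum_le_sum fun S hS => download_le h0 (Finset.mem_filter.1 hS).2
    have h2 : (D / L + objective K α) * L = D + L * objective K α := by field_simp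
    rw [h2]
    linarith

end Achievability

/-! ### The optimal cost is the value of the linear program -/

section Minimum

variable {N K : ℕ} {m : Fin N → ℝ}

/-- Bits that are stored nowhere do not matter in the linear program. -/
lemma update_empty_mem_feasible {α : Finset (Fin N) → ℝ} (hα : α ∈ feasible m) :
    Function.update α ∅ 0 ∈ feasible m := by
  obtain ⟨h0, hsum, hmem⟩ := hα
  refine ⟨fun S => ?_, ?_, fun n => ?_⟩
  · rcases eq_or_ne S ∅ with rfl | hS
    · simp
    · rw [Function.update_of_ne hS]; exact h0 S
  · rw [← hsum]
    refine Finset.sum_congr rfl fun S hS => Function.update_of_ne ?_ _ _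
    rintro rfl
    simp at hS
  · refine le_of_eq_of_le (Finset.sum_congr rfl fun S hS => Function.update_of_ne ?_ _ _) (hmem n)
    rintro rfl
    simp at hS

lemma objective_update_empty (α : Finset (Fin N) → ℝ) :
    objective K (Function.update α ∅ 0) = objective K α := by
  rw [objective_eq, objective_eq]
  refine Finset.sum_congr rfl fun S hS => ?_
  rw [Function.update_of_ne]
  rintro rfl
  simp at hS

/-- A feasible program attains its minimum. The feasible set itself is not compact, because the
share of the empty set is unconstrained; the slice where that share vanishes is. -/
lemma exists_isMinOn_objective (h : (feasible m).Nonempty) :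
    ∃ α ∈ feasible m, IsMinOn (objective K) (feasible m) α := by
  obtain ⟨α₀, hα₀⟩ := h
  have hclosed : IsClosed (feasible m) := by
    have h1 : IsClosed {α : Finset (Fin N) → ℝ | ∀ S, 0 ≤ α S} := by
      simp only [Set.ofPred_forall]
      exact isClosed_iInter fun S => isClosed_le continuous_const (continuous_apply S)
    have h2 : IsClosed {α : Finset (Fin N) → ℝ |
        ∑ S : Finset (Fin N) with 1 ≤ S.card, α S = 1} :=
      isClosed_eq (by fun_prop) continuous_const
    have h3 : IsClosed {α : Finset (Fin N) → ℝ |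
        ∀ n : Fin N, ∑ S : Finset (Fin N) with n ∈ S, α S ≤ m n} := by
      simp only [Set.ofPred_forall]
      exact isClosed_iInter fun n => isClosed_le (by fun_prop) continuous_const
    exact h1.inter (h2.inter h3)
  have hcompact : IsCompact (feasible m ∩ {α | α ∅ = 0}) := by
    refine isCompact_Icc.of_isClosed_subset (s := Set.Icc 0 1)
      (hclosed.inter (isClosed_eq (continuous_apply _) continuous_const)) ?_
    rintro α ⟨⟨h0, hsum, -⟩, hempty⟩
    refine ⟨h0, fun S => ?_⟩
    rcases S.eq_empty_or_nonempty with rfl | hS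
    · rw [hempty]; exact zero_le_one
    · rw [Pi.one_apply, ← hsum]
      exact Finset.single_le_sum (fun S _ => h0 S)
        (Finset.mem_filter.2 ⟨Finset.mem_univ S, hS.card_pos⟩)
  obtain ⟨α, hα, hmin⟩ := hcompact.exists_isMinOn
    ⟨_, update_empty_mem_feasible hα₀, Function.update_self _ _ _⟩
    (continuous_objective K).continuousOn
  refine ⟨α, hα.1, fun β hβ => ?_⟩
  have := hmin ⟨update_empty_mem_feasible hβ, Function.update_self _ _ _⟩
  rwa [Set.mem_ofPred_eq, objective_update_empty] at this

lemma optimalCost_eq_iInf (hK : 1 ≤ K) (hm : ∀ n, 0 ≤ m n) :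
    optimalCost m K = ⨅ α ∈ feasible m, ENNReal.ofReal (objective K α) := by
  refine le_antisymm (le_iInf₂ fun α hα => sInf_le (isAchievable_of_feasible hα))
    (le_sInf fun d hd => ?_)
  rcases eq_or_ne d ⊤ with rfl | hd'
  · exact le_top
  · obtain ⟨α, hα, hle⟩ := exists_feasible_of_isAchievable hK hm hd' hd
    exact (iInf₂_le α hα).trans hle

end Minimum

end

end HetPIR

/-- The optimal normalized download cost is the optimal value of the linear program
(both are `∞` if the program is infeasible), and a feasible program attains its minimum. -/
theorem theorem1 (N K : ℕ) (hK : 1 ≤ K) (m : Fin N → ℝ) (hm : ∀ n, 0 ≤ m n ∧ m n ≤ 1) :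
    HetPIR.optimalCost m K =
        ⨅ α ∈ HetPIR.feasible m, ENNReal.ofReal (HetPIR.objective K α) ∧
      ((HetPIR.feasible m).Nonempty →
        ∃ α ∈ HetPIR.feasible m, IsMinOn (HetPIR.objective K) (HetPIR.feasible m) α ∧
          HetPIR.optimalCost m K = ENNReal.ofReal (HetPIR.objective K α)) := by
  have h := HetPIR.optimalCost_eq_iInf hK fun n => (hm n).1
  refine ⟨h, fun hne => ?_⟩
  obtain ⟨α, hα, hmin⟩ := HetPIR.exists_isMinOn_objective (K := K) hne
  refine ⟨α, hα, hmin, h.trans (le_antisymm (iInf₂_le α hα) (le_iInf₂ fun β hβ => ?_))⟩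
  exact ENNReal.ofReal_le_ofReal (hmin hβ)
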